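/- **Setting.** Let $\mathbf V$ be a finite set of random variables (observed or not), where each $V\in\mathbf V$ takes values in a measurable space with a $\sigma$-finite reference measure, and let $\mathcal D$ be a directed acyclic graph on $\mathbf V$. A family $\{f(\mathbf v\mid do(\mathbf x)):\mathbf X\subseteq\mathbf V\}$ of interventional densities with observational density $f(\mathbf v)$ (the case $\mathbf X=\emptyset$) is *consistent with* $\mathcal D$ if $f(\mathbf v)$ is an everywhere positive probability density and, for every $\mathbf X\subseteq\mathbf V$, $$f(\mathbf v\mid do(\mathbf x))=\prod_{V_i\in\mathbf V\setminus\mathbf X} f(v_i\mid \mathrm{pa}(v_i,\mathcal D))\,\mathbf 1(\mathbf X=\mathbf x).$$ A *causal model* induces a DAG $\mathcal D$ and a family of interventional densities consistent with $\mathcal D$ whose observational density $f$ is faithful to $\mathcal D$: for pairwise disjoint $\mathbf A,\mathbf B,\mathbf C$, conditional independence $\mathbf A\perp\!\!\!\perp\mathbf B\mid\mathbf C$ under $f$ implies that $\mathbf A$ and $\mathbf B$ are d-separated given $\mathbf C$ in $\mathcal D$. Equalities of densities are understood almost everywhere. Every node counts as an ancestor and a descendant of itself. A set $\mathbf A$ *has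 a causal effect on* a disjoint set $\mathbf B$ if there is a directed path in $\mathcal D$ from a node of $\mathbf A$ to a node of $\mathbf B$. For sets of variables, $\mathbf A_1<\dots<\mathbf A_m$ is a *causal ordering consistent with the model* if no node of $\mathbf A_j$ is an ancestor of a node of $\mathbf A_i$ for $i<j$. For pairwise disjoint $\mathbf X,\mathbf Y,\mathbf Z$, the set $\mathbf Z$ is an *adjustment set relative to* $(\mathbf X,\mathbf Y)$ if $$f(\mathbf y\mid do(\mathbf x))=\int f(\mathbf y\mid\mathbf x,\mathbf z)f(\mathbf z)\,d\mathbf z$$ for every family consistent with $\mathcal D$ (over all state spaces and reference measures); it is *minimal* if no proper subset of it is an adjustment set relative to $(\mathbf X,\mathbf Y)$. **Theorem 3 (R1 Combine).** Let $\mathbf X=\{X_1,\dots,X_k\}$, $k\ge 1$, $\{Y\}$ and $\mathbf W$ be pairwise disjoint sets of observed random variables in a causal model, and let $\mathbf X^N_i$ be the set of variables in $\mathbf X$ that are not descendants of $X_i$. Suppose that $\mathbf W<\mathbf X<Y$ is a causal ordering consistent with the model, and that there are $W_1,\dots,W_k\in\mathbf W$ and sets $\mathbf T_i\subseteq[\mathbf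 W\setminus\{W_1,\dots,W_k\}]\cup\mathbf X^N_i$ such that for all $i\in\{1,\dots,k\}$ 1. $W_i\not\!\perp\!\!\!\perp Y\mid\mathbf T_i$, and 2. $W_i\perp\!\!\!\perp Y\mid\mathbf T_i\cup\{X_i\}$. Then $\mathbf X$ has a causal effect on $Y$; for every $i$ there is a minimal adjustment set relative to $(X_i,Y)$ contained in $\mathbf T_i$; and for any choice of minimal adjustment sets $\mathbf Z_i\subseteq\mathbf T_i$ relative to $(X_i,Y)$, $i=1,\dots,k$, the causal effect of $\mathbf X$ on $Y$ is identified by the adjustment set $\mathbf Z:=\big(\bigcup_{i=1}^k\mathbf Z_i\big)\setminus\mathbf X$, that is, $\mathbf Z$ is an adjustment set relative to $(\mathbf X,Y)$. -/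

import Mathlib

open MeasureTheory
open scoped ENNReal

universe u w

/-- A directed acyclic graph on the node set `V`. -/
structure DAG (V : Type w) extends Digraph V where
  acyclic : ∀ v, ¬ Relation.TransGen Adj v v

namespace DAG

variable {V : Type w} (D : DAG V)

/-- `a` is an ancestor of `b` (every node is an ancestor of itself). -/
def IsAncestor (a b : V) : Prop := Relation.ReflTransGen D.Adj a b

/-- `p` is a path from `a` to `b`: a sequence of distinct nodes, successive ones adjacent. -/
structure IsPath (p : List V) (a b : V) : Prop where
  nodup : p.Nodup
  adjacent : p.IsChain (fun u v => D.Adj u v ∨ D.Adj v u)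
  head : p.head? = some a
  last : p.getLast? = some b

/-- On the consecutive nodes `a, c, b` of a path, `c` is a collider: `a → c ← b`. -/
def IsCollider (a c b : V) : Prop := D.Adj a c ∧ D.Adj b c

/-- The path `p` is open (d-connecting) given `C`: no non-collider on `p` is in `C`, and every
collider on `p` has a descendant in `C`. Endpoints are neither colliders nor non-colliders. -/
def IsOpen (p : List V) (C : Finset V) : Prop :=
  ∀ a c b, [a, c, b] <:+: p →
    (D.IsCollider a c b → ∃ z ∈ C, D.IsAncestor c z) ∧ (¬ D.IsCollider a c b → c ∉ C)

/-- `A` and `B` are d-separated given `C`: every path between them is blocked. -/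
def DSep (A B C : Finset V) : Prop :=
  ∀ a ∈ A, ∀ b ∈ B, ∀ p, D.IsPath p a b → ¬ D.IsOpen p C

/-- The list of node sets `S₁ < ⋯ < Sₘ` is a causal ordering consistent with the graph: no node of
a later set is an ancestor of a node of an earlier one. -/
def IsCausalOrdering (S : List (Finset V)) : Prop :=
  S.Pairwise fun A B => ∀ a ∈ A, ∀ b ∈ B, ¬ D.IsAncestor b a

/-- `A` has a causal effect on `B`: there is a causal (that is, directed) path from a node of `A` to
a node of `B`. This is used for disjoint `A` and `B` only. -/
def HasCausalEffect (A B : Finset V) : Prop := ∃ a ∈ A, ∃ b ∈ B, D.IsAncestor a b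

open Classical in
/-- The nodes of `S` that are not descendants of `a`. -/
noncomputable def nonDescendantsIn (S : Finset V) (a : V) : Finset V :=
  S.filter fun v => ¬ D.IsAncestor a v

open Classical in
/-- The parents of a node. -/
noncomputable def parents [Fintype V] (v : V) : Finset V :=
  Finset.univ.filter fun a => D.Adj a v

end DAG

section Densities

variable {V : Type w} [Fintype V] [DecidableEq V] {Ω : V → Type u} [∀ v, MeasurableSpace (Ω v)]

/-- The marginal density `f(v_S)`: all coordinates outside `S` are integrated out. It is a function
of the full assignment that depends on the coordinates in `S` only. -/
noncomputable def marginalDensity (μ : ∀ v, Measure (Ω v)) (f : (∀ v, Ω v) → ℝ≥0∞)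
    (S : Finset V) : (∀ v, Ω v) → ℝ≥0∞ :=
  ∫⋯∫⁻_Sᶜ, f ∂μ

/-- The conditional density `f(v_A | v_B) = f(v_A, v_B) / f(v_B)`. -/
noncomputable def condDensity (μ : ∀ v, Measure (Ω v)) (f : (∀ v, Ω v) → ℝ≥0∞)
    (A B : Finset V) : (∀ v, Ω v) → ℝ≥0∞ :=
  fun v => marginalDensity μ f (A ∪ B) v / marginalDensity μ f B v

/-- Conditional independence `(A ⟂ B | C)_f`: `f(a, b, c) f(c) = f(a, c) f(b, c)` almost everywhere. -/
def CondIndepDensity (μ : ∀ v, Measure (Ω v)) (f : (∀ v, Ω v) → ℝ≥0∞) (A B C : Finset V) : Prop :=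
  (fun v => marginalDensity μ f (A ∪ B ∪ C) v * marginalDensity μ f C v) =ᵐ[Measure.pi μ]
    fun v => marginalDensity μ f (A ∪ C) v * marginalDensity μ f (B ∪ C) v

/-- The density `f` is faithful to `D`: conditional independence implies d-separation. -/
def IsFaithful (D : DAG V) (μ : ∀ v, Measure (Ω v)) (f : (∀ v, Ω v) → ℝ≥0∞) : Prop :=
  ∀ A B C : Finset V, Disjoint A B → Disjoint A C → Disjoint B C →
    CondIndepDensity μ f A B C → D.DSep A B C

/-- A family of interventional densities. Since `f(v | do(x))` vanishes unless `v` agrees with `x` on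
the intervened set `X`, it is recorded by its values there: `F X v` is `f(v | do(x))` at `x = v_X`,
a density with respect to the reference measures of the coordinates outside `X`. In particular
`F ∅` is the observational density. -/
abbrev InterventionalFamily {V : Type w} (Ω : V → Type u) := Finset V → (∀ v, Ω v) → ℝ≥0∞

/-- `D` is a causal Bayesian network compatible with the family `F`: the observational density is a
positive probability density and every member of `F` is given by the truncated factorization
`f(v | do(x)) = ∏_{i ∉ X} f(v_i | pa(v_i))` on `v_X = x`. For `X = ∅` this is Markov compatibility. -/
structure IsCompatible (D : DAG V) (μ : ∀ v, Measure (Ω v)) (F : InterventionalFamily Ω) : Prop where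
  measurable : ∀ X, Measurable (F X)
  pos : ∀ v, 0 < F ∅ v
  lt_top : ∀ v, F ∅ v < ∞
  lintegral_eq_one : ∫⁻ v, F ∅ v ∂(Measure.pi μ) = 1
  truncated_factorization : ∀ X : Finset V,
    F X =ᵐ[Measure.pi μ] fun v => ∏ i ∈ Xᶜ, condDensity μ (F ∅) {i} (D.parents i) v

/-- The interventional density `f(y | do(x))`, as a function of the coordinates in `X ∪ Y`. -/
noncomputable def doDensity (μ : ∀ v, Measure (Ω v)) (F : InterventionalFamily Ω)
    (X Y : Finset V) : (∀ v, Ω v) → ℝ≥0∞ :=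
  ∫⋯∫⁻_(X ∪ Y)ᶜ, F X ∂μ

/-- The adjustment functional `∫ f(y | x, z) f(z) dz`, as a function of the coordinates in `X ∪ Y`. -/
noncomputable def adjustmentDensity (μ : ∀ v, Measure (Ω v)) (f : (∀ v, Ω v) → ℝ≥0∞)
    (X Y Z : Finset V) : (∀ v, Ω v) → ℝ≥0∞ :=
  ∫⋯∫⁻_Z, (fun v => condDensity μ f Y (X ∪ Z) v * marginalDensity μ f Z v) ∂μ

end Densities

/-- `Z` is an adjustment set relative to `(X, Y)` in `D`: the three sets are pairwise disjoint and
`f(y | do(x)) = ∫ f(y | x, z) f(z) dz` for every `f` consistent with `D`, over all state spaces and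
all σ-finite reference measures. -/
def IsAdjustmentSet {V : Type w} [Fintype V] [DecidableEq V] (D : DAG V) (X Y Z : Finset V) : Prop :=
  (Disjoint X Y ∧ Disjoint X Z ∧ Disjoint Y Z) ∧
    ∀ (Ω : V → Type u) [∀ v, MeasurableSpace (Ω v)] (μ : ∀ v, Measure (Ω v))
      [∀ v, SigmaFinite (μ v)] (F : InterventionalFamily Ω), IsCompatible D μ F →
        doDensity μ F X Y =ᵐ[Measure.pi μ] adjustmentDensity μ (F ∅) X Y Z

/-- A minimal adjustment set: no proper subset is an adjustment set. -/
def IsMinimalAdjustmentSet {V : Type w} [Fintype V] [DecidableEq V] (D : DAG V)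
    (X Y Z : Finset V) : Prop :=
  IsAdjustmentSet.{u} D X Y Z ∧ ∀ Z', Z' ⊂ Z → ¬ IsAdjustmentSet.{u} D X Y Z'

/-- A causal model, given by what it induces: a causal DAG over the variables (observed or not), a
family of interventional densities consistent with it, and faithfulness of the observational
density. -/
structure CausalModel {V : Type w} [Fintype V] [DecidableEq V] (Ω : V → Type u)
    [∀ v, MeasurableSpace (Ω v)] (μ : ∀ v, Measure (Ω v)) where
  graph : DAG V
  family : InterventionalFamily Ω
  compatible : IsCompatible graph μ family
  faithful : IsFaithful graph μ (family ∅)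

/-- The observational joint density of a causal model. -/
def CausalModel.density {V : Type w} [Fintype V] [DecidableEq V] {Ω : V → Type u}
    [∀ v, MeasurableSpace (Ω v)] {μ : ∀ v, Measure (Ω v)} (M : CausalModel Ω μ) :
    (∀ v, Ω v) → ℝ≥0∞ :=
  M.family ∅

/-!
By the Markov property and faithfulness, conditional independence can be read off moral graphs. As
`Wᵢ` is dependent on `Y` given `Tᵢ` but not given `Tᵢ ∪ {Xᵢ}`, every moral connection between them
enters `Xᵢ`. This makes `Xᵢ` an ancestor of `Y`, and `Tᵢ` satisfies the back-door criterion for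
`(Xᵢ, Y)`: a back-door connection from `Xᵢ` to `Y` would prolong a connection from `Wᵢ`.

The criterion is sound by a factorization of the density along moral components. Conversely, without
it some walk from `Xᵢ` to `Y` starts against an edge into `Xᵢ` and has exactly its colliders in the
adjusting set. Put a bit on each node of the walk, almost always the sum of the bits of its parents
on the walk. Given the colliders, the bit at `Y` then depends on that at `Xᵢ`, although
intervening on `Xᵢ` does not change it. So minimal adjustment sets consist of ancestors of `Xᵢ` and
`Y`, and a back-door connection from some `Xᵢ` to `Y` given `X ∪ Z` would already violate the
criterion for `Zᵢ`.
-/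

/-! ### Moral graphs and open walks -/

namespace DAG

variable {V : Type w} {D : DAG V}

lemma adj_asymm {u v : V} (h : D.Adj u v) : ¬ D.Adj v u :=
  fun h' => D.acyclic u (.tail (.single h) h')

lemma adj_ne {u v : V} (h : D.Adj u v) : u ≠ v := by
  rintro rfl
  exact D.acyclic u (.single h)

lemma not_isAncestor_of_adj {u v : V} (h : D.Adj u v) : ¬ D.IsAncestor v u :=
  fun h' => D.acyclic u (Relation.TransGen.head' h h')

section Ancestors

variable [Fintype V]

open Classical in
variable (D) in
/-- The ancestors of the nodes of a set, the nodes themselves included. -/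
noncomputable def ancestors (A : Finset V) : Finset V :=
  Finset.univ.filter fun v => ∃ a ∈ A, D.IsAncestor v a

variable {A B : Finset V} {u v : V}

lemma mem_ancestors : v ∈ D.ancestors A ↔ ∃ a ∈ A, D.IsAncestor v a := by
  simp [ancestors]

lemma mem_ancestors_of_mem (h : v ∈ A) : v ∈ D.ancestors A :=
  mem_ancestors.2 ⟨v, h, .refl⟩

lemma mem_ancestors_of_isAncestor (h : D.IsAncestor u v) (hv : v ∈ D.ancestors A) :
    u ∈ D.ancestors A := by
  obtain ⟨a, ha, hva⟩ := mem_ancestors.1 hv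
  exact mem_ancestors.2 ⟨a, ha, h.trans hva⟩

lemma ancestors_subset_ancestors (h : A ⊆ D.ancestors B) : D.ancestors A ⊆ D.ancestors B := by
  intro v hv
  obtain ⟨a, ha, hva⟩ := mem_ancestors.1 hv
  exact mem_ancestors_of_isAncestor hva (h ha)

lemma ancestors_mono (h : A ⊆ B) : D.ancestors A ⊆ D.ancestors B :=
  ancestors_subset_ancestors fun _ ha => mem_ancestors_of_mem (h ha)

end Ancestors

variable (D) in
/-- Adjacency in the moral graph of the nodes `S`, with the nodes of `C` removed: two nodes are
adjacent if they lie in a common set `{w} ∪ pa(w)` with `w ∈ S`. -/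
def MoralAdj (S C : Finset V) (u v : V) : Prop :=
  u ∉ C ∧ v ∉ C ∧ ∃ w ∈ S, (u = w ∨ D.Adj u w) ∧ (v = w ∨ D.Adj v w)

variable (D) in
/-- Connectedness in the moral graph of `S` with `C` removed. -/
def MoralConn (S C : Finset V) : V → V → Prop := Relation.ReflTransGen (D.MoralAdj S C)

section Moral

variable {S S' C : Finset V} {u v : V}

lemma MoralAdj.symm (h : D.MoralAdj S C u v) : D.MoralAdj S C v u := by
  obtain ⟨hu, hv, w, hw, huw, hvw⟩ := h
  exact ⟨hv, hu, w, hw, hvw, huw⟩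

lemma MoralAdj.of_adj (h : D.Adj u v) (hu : u ∉ C) (hv : v ∉ C) (hS : v ∈ S) :
    D.MoralAdj S C u v :=
  ⟨hu, hv, v, hS, Or.inr h, Or.inl rfl⟩

lemma MoralAdj.mono (hS : S ⊆ S') (h : D.MoralAdj S C u v) : D.MoralAdj S' C u v := by
  obtain ⟨hu, hv, w, hw, h⟩ := h
  exact ⟨hu, hv, w, hS hw, h⟩

lemma MoralConn.symm (h : D.MoralConn S C u v) : D.MoralConn S C v u :=
  haveI : Std.Symm (D.MoralAdj S C) := ⟨fun _ _ => MoralAdj.symm⟩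
  symm_of (Relation.ReflTransGen (D.MoralAdj S C)) h

lemma MoralConn.mono (hS : S ⊆ S') (h : D.MoralConn S C u v) : D.MoralConn S' C u v :=
  Relation.ReflTransGen.mono (fun _ _ => MoralAdj.mono hS) _ _ h

lemma MoralConn.notMem (h : D.MoralConn S C u v) (hu : u ∉ C) : v ∉ C := by
  rcases Relation.ReflTransGen.cases_tail h with rfl | ⟨c, -, hc⟩
  · exact hu
  · exact hc.2.1

lemma MoralConn.of_isAncestor (h : D.IsAncestor u v) (hS : ∀ t, D.IsAncestor t v → t ∈ S)
    (hC : ∀ t, D.IsAncestor u t → D.IsAncestor t v → t ∉ C) : D.MoralConn S C u v := by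
  induction h using Relation.ReflTransGen.head_induction_on with
  | refl => exact .refl
  | @head a c hac hcv ih =>
    refine .head (MoralAdj.of_adj hac ?_ ?_ (hS c hcv)) (ih fun t ht htv => hC t (.head hac ht) htv)
    · exact hC a .refl (.head hac hcv)
    · exact hC c (.single hac) hcv

lemma MoralConn.exists_moralAdj [DecidableEq V] (h : D.MoralConn S C u v) (huv : u ≠ v) :
    ∃ c, c ≠ u ∧ D.MoralAdj S C u c ∧ D.MoralConn S (insert u C) c v := by
  suffices ∀ b, D.MoralConn S C u b →
      b = u ∨ ∃ c, c ≠ u ∧ D.MoralAdj S C u c ∧ D.MoralConn S (insert u C) c b from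
    (this v h).resolve_left huv.symm
  intro b hb
  induction hb with
  | refl => exact .inl rfl
  | @tail b b' _ hbb' ih =>
    by_cases hb'u : b' = u
    · exact .inl hb'u
    right
    rcases ih with rfl | ⟨c, hcu, huc, hcb⟩
    · exact ⟨b', hb'u, hbb', .refl⟩
    · have hb : b ∉ insert u C := hcb.notMem (by simp [hcu, huc.2.1])
      exact ⟨c, hcu, huc, hcb.tail ⟨hb, by simp [hb'u, hbb'.2.1], hbb'.2.2⟩⟩

lemma MoralConn.exists_moralAdj_of_not_moralConn [DecidableEq V] {x : V}
    (h : D.MoralConn S C u v) (hsep : ¬ D.MoralConn S ({x} ∪ C) u v) (hu : u ∉ {x} ∪ C) :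
    ∃ m, D.MoralConn S ({x} ∪ C) u m ∧ D.MoralAdj S C m x := by
  suffices ∀ t, D.MoralConn S C u t → D.MoralConn S ({x} ∪ C) u t ∨
      ∃ m, D.MoralConn S ({x} ∪ C) u m ∧ D.MoralAdj S C m x from (this v h).resolve_left hsep
  intro t ht
  induction ht with
  | refl => exact .inl .refl
  | @tail t t' _ htt' ih =>
    rcases ih with ih | ih
    · by_cases ht' : t' = x
      · exact .inr ⟨t, ih, ht' ▸ htt'⟩
      · exact .inl (ih.tail ⟨ih.notMem hu, by simp [htt'.2.1, ht'], htt'.2.2⟩)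
    · exact .inr ih

end Moral

/-- The states reached by walks from `x` on which the inner nodes differ from `x` and `y` and
are colliders exactly if they lie in `Z`. The Boolean tells whether the last edge points into the
last node. Unless `out` holds, the first edge has to point into `x`. -/
inductive Reach (D : DAG V) (x y : V) (Z : Finset V) (out : Prop) : V → Bool → Prop
  | start {v : V} : D.Adj v x → Reach D x y Z out v false
  | startOut {v : V} : out → D.Adj x v → Reach D x y Z out v true
  | down {u v : V} {d : Bool} : Reach D x y Z out u d → u ∉ Z → u ≠ y → D.Adj u v → v ≠ x →
      Reach D x y Z out v true
  | up {u v : V} : Reach D x y Z out u false → u ∉ Z → u ≠ y → D.Adj v u → v ≠ x →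
      Reach D x y Z out v false
  | bounce {u v : V} : Reach D x y Z out u true → u ∈ Z → u ≠ y → D.Adj v u → v ≠ x →
      Reach D x y Z out v false

section Reach

variable {x y u v : V} {Z S C : Finset V} {out : Prop} {d : Bool}

lemma Reach.ne (h : D.Reach x y Z out v d) : v ≠ x := by
  cases h with
  | start h => exact adj_ne h
  | startOut _ h => exact (adj_ne h).symm
  | down _ _ _ _ h => exact h
  | up _ _ _ _ h => exact h
  | bounce _ _ _ _ h => exact h

variable [Fintype V] [DecidableEq V]

/-- The walk descends to the nearest node of `Z ∪ {x, y}` and, unless this is `y`, comes back. -/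
lemma Reach.turn (h : D.Reach x y Z out u true) (hu : u ∈ D.ancestors (insert x (insert y Z)))
    (huZ : u ∉ Z) (huy : u ≠ y) :
    (∃ d, D.Reach x y Z out y d) ∨ D.Reach x y Z out u false := by
  obtain ⟨t, ht, hut⟩ := mem_ancestors.1 hu
  clear hu
  induction hut using Relation.ReflTransGen.head_induction_on with
  | refl => exact absurd ht (by simp [h.ne, huy, huZ])
  | @head a c hac _ ih =>
    by_cases hcx : c = x
    · exact .inr (.start (hcx ▸ hac))
    have hc := h.down huZ huy hac hcx
    by_cases hcy : c = y
    · exact .inl ⟨_, hcy ▸ hc⟩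
    by_cases hcZ : c ∈ Z
    · exact .inr (hc.bounce hcZ hcy hac h.ne)
    · exact (ih hc hcZ hcy).imp id fun h' => h'.up hcZ hcy hac h.ne

lemma Reach.to_parent (h : D.Reach x y Z out u true)
    (hu : u ∈ D.ancestors (insert x (insert y Z))) (hvu : D.Adj v u) (hv : v ≠ x) :
    (∃ d, D.Reach x y Z out y d) ∨ ∃ d, D.Reach x y Z out v d := by
  by_cases huy : u = y
  · exact .inl ⟨_, huy ▸ h⟩
  by_cases huZ : u ∈ Z
  · exact .inr ⟨_, h.bounce huZ huy hvu hv⟩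
  · exact (h.turn hu huZ huy).imp id fun h' => ⟨_, h'.up huZ huy hvu hv⟩

lemma Reach.step (h : D.Reach x y Z out u d) (hS : S ⊆ D.ancestors (insert x (insert y Z)))
    (hZC : Z ⊆ C) (huv : D.MoralAdj S C u v) (huy : u ≠ y) (hv : v ≠ x) :
    (∃ d, D.Reach x y Z out y d) ∨ ∃ d, D.Reach x y Z out v d := by
  obtain ⟨huC, -, w, hwS, huw, hvw⟩ := huv
  have huZ : u ∉ Z := fun hu => huC (hZC hu)
  rcases huw with rfl | huw <;> rcases hvw with rfl | hvw
  · exact .inr ⟨d, h⟩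
  · cases d
    · exact .inr ⟨_, h.up huZ huy hvw hv⟩
    · exact h.to_parent (hS hwS) hvw hv
  · exact .inr ⟨_, h.down huZ huy huw hv⟩
  · by_cases hwx : w = x
    · exact .inr ⟨_, .start (hwx ▸ hvw)⟩
    · exact (h.down huZ huy huw hwx).to_parent (hS hwS) hvw hv

lemma Reach.trans_moralConn (h : D.Reach x y Z out u d)
    (hS : S ⊆ D.ancestors (insert x (insert y Z))) (hZC : Z ⊆ C) (hx : x ∈ C)
    (huy : D.MoralConn S C u y) : ∃ d, D.Reach x y Z out y d := by
  suffices ∀ b, D.MoralConn S C u b →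
      (∃ d, D.Reach x y Z out y d) ∨ ∃ d, D.Reach x y Z out b d by
    simpa using this y huy
  intro b hb
  induction hb with
  | refl => exact .inr ⟨d, h⟩
  | @tail b c _ hbc ih =>
    rcases ih with ih | ⟨d, ih⟩
    · exact .inl ih
    by_cases hby : b = y
    · exact .inl ⟨d, hby ▸ ih⟩
    · exact ih.step hS hZC hbc hby (fun hc => hbc.2.1 (hc ▸ hx))

lemma Reach.of_moralAdj (hS : S ⊆ D.ancestors (insert x (insert y Z)))
    (h : D.MoralAdj S C x v) (hv : v ≠ x) :
    (∃ d, D.Reach x y Z True y d) ∨ ∃ d, D.Reach x y Z True v d := by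
  obtain ⟨-, -, w, hwS, hxw, hvw⟩ := h
  rcases hxw with rfl | hxw <;> rcases hvw with rfl | hvw
  · exact absurd rfl hv
  · exact .inr ⟨_, .start hvw⟩
  · exact .inr ⟨_, .startOut trivial hxw⟩
  · exact (Reach.startOut trivial hxw).to_parent (hS hwS) hvw hv

lemma MoralConn.exists_reach (h : D.MoralConn S Z x y) (hxy : x ≠ y)
    (hS : S ⊆ D.ancestors (insert x (insert y Z))) : ∃ d, D.Reach x y Z True y d := by
  obtain ⟨c, hcx, hxc, hcy⟩ := h.exists_moralAdj hxy
  rcases Reach.of_moralAdj hS hxc hcx with hy | ⟨d, hc⟩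
  · exact hy
  · exact hc.trans_moralConn hS (Finset.subset_insert x Z) (Finset.mem_insert_self x Z) hcy

end Reach

/-- A sequence of nodes, not necessarily distinct, with successive ones adjacent, that is open
given `C`: a path from `a` to `b` that is open given `C`, except that it may repeat nodes. -/
structure IsOpenWalk (D : DAG V) (p : List V) (a b : V) (C : Finset V) : Prop where
  adjacent : p.IsChain (fun u v => D.Adj u v ∨ D.Adj v u)
  head : p.head? = some a
  last : p.getLast? = some b
  isOpen : D.IsOpen p C

section OpenWalk

variable {C : Finset V} {a b u v t : V} {l m : List V}

lemma IsOpen.of_infix {p q : List V} (h : D.IsOpen q C) (hpq : p <:+: q) : D.IsOpen p C :=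
  fun a c b habc => h a c b (habc.trans hpq)

lemma IsOpenWalk.pair (h : D.Adj u v ∨ D.Adj v u) : D.IsOpenWalk [u, v] u v C :=
  ⟨by simpa using h, rfl, rfl, fun _ _ _ habc => absurd habc.length_le (by simp)⟩

lemma IsOpenWalk.cons (h : D.IsOpenWalk (u :: t :: l) u b C) (hvu : D.Adj v u ∨ D.Adj u v)
    (hcol : D.IsCollider v u t → ∃ z ∈ C, D.IsAncestor u z)
    (hncol : ¬ D.IsCollider v u t → u ∉ C) : D.IsOpenWalk (v :: u :: t :: l) v b C := by
  refine ⟨List.isChain_cons_cons.2 ⟨hvu, h.adjacent⟩, rfl, ?_, fun a c b habc => ?_⟩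
  · rw [List.getLast?_cons_cons]
    exact h.last
  · rcases List.infix_cons_iff.1 habc with habc | habc
    · simp only [List.cons_prefix_cons, List.nil_prefix, and_true] at habc
      obtain ⟨rfl, rfl, rfl⟩ := habc
      exact ⟨hcol, hncol⟩
    · exact h.isOpen a c b habc

lemma Reach.exists_isOpenWalk {x y : V} {Z : Finset V} {out : Prop} {d : Bool}
    (h : D.Reach x y Z out v d) :
    ∃ u l, D.IsOpenWalk (v :: u :: l) v x Z ∧ (d = true → D.Adj u v) ∧
      (d = false → D.Adj v u) := by
  induction h with
  | @start v h => exact ⟨x, [], .pair (.inl h), by simp, fun _ => h⟩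
  | @startOut v _ h => exact ⟨x, [], .pair (.inr h), fun _ => h, by simp⟩
  | @down u v d _ huZ _ huv _ ih =>
    obtain ⟨t, l, hw, -, -⟩ := ih
    exact ⟨u, t :: l, hw.cons (.inr huv) (fun hc => absurd hc.1 (adj_asymm huv)) fun _ => huZ,
      fun _ => huv, by simp⟩
  | @up u v _ huZ _ hvu _ ih =>
    obtain ⟨t, l, hw, -, hut⟩ := ih
    exact ⟨u, t :: l, hw.cons (.inl hvu) (fun hc => absurd hc.2 (adj_asymm (hut rfl)))
      fun _ => huZ, by simp, fun _ => hvu⟩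
  | @bounce u v _ huZ _ hvu _ ih =>
    obtain ⟨t, l, hw, htu, -⟩ := ih
    exact ⟨u, t :: l, hw.cons (.inl hvu) (fun _ => ⟨u, huZ, .refl⟩)
      fun hc => absurd ⟨hvu, htu rfl⟩ hc, by simp, fun _ => hvu⟩

/-- The last node of the initial directed stretch is a collider. -/
lemma IsOpen.exists_isAncestor
    (hadj : (v :: u :: l).IsChain (fun u v => D.Adj u v ∨ D.Adj v u))
    (hopen : D.IsOpen (v :: u :: l) C) (hvu : D.Adj v u) (hl : v :: u :: l = m ++ [a, b])
    (hba : D.Adj b a) : ∃ z ∈ C, D.IsAncestor v z := by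
  induction l generalizing v u m with
  | nil =>
    obtain rfl : m = [] := by simpa using congrArg List.length hl
    simp only [List.nil_append, List.cons.injEq, and_true] at hl
    obtain ⟨rfl, rfl⟩ := hl
    exact absurd hba (adj_asymm hvu)
  | cons t l ih =>
    rw [List.isChain_cons_cons] at hadj
    rcases (List.isChain_cons_cons.1 hadj.2).1 with hut | htu
    · cases m with
      | nil => simp at hl
      | cons m₀ m =>
        simp only [List.cons_append, List.cons.injEq] at hl
        obtain ⟨z, hz, huz⟩ :=
          ih hadj.2 (hopen.of_infix (List.suffix_cons _ _).isInfix) hut hl.2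
        exact ⟨z, hz, .head hvu huz⟩
    · obtain ⟨z, hz, huz⟩ := (hopen v u t ⟨[], l, rfl⟩).1 ⟨hvu, htu⟩
      exact ⟨z, hz, .head hvu huz⟩

end OpenWalk

lemma triple_infix_append_cons {α : Type*} {a c b v : α} {l₁ l₃ : List α}
    (h : [a, c, b] <:+: l₁ ++ v :: l₃) :
    [a, c, b] <:+: l₁ ++ [v] ∨ [a, c, b] <:+: v :: l₃ ∨
      ∃ m m', l₁ = m ++ [a] ∧ c = v ∧ l₃ = b :: m' := by
  induction l₁ with
  | nil => exact .inr (.inl h)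
  | cons w l₁ ih =>
    rw [List.cons_append, List.infix_cons_iff] at h
    rcases h with h | h
    · match l₁, l₃, h with
      | [], [], h => exact absurd h.length_le (by simp)
      | [], b' :: l₃, h =>
        simp only [List.nil_append, List.cons_prefix_cons, List.nil_prefix, and_true] at h
        obtain ⟨rfl, rfl, rfl⟩ := h
        exact .inr (.inr ⟨[], l₃, rfl, rfl, rfl⟩)
      | [w'], _, h =>
        simp only [List.cons_append, List.nil_append, List.cons_prefix_cons, List.nil_prefix,
          and_true] at h
        obtain ⟨rfl, rfl, rfl⟩ := h
        exact .inl (List.infix_refl _)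
      | w' :: w'' :: l, _, h =>
        simp only [List.cons_append, List.cons_prefix_cons, List.nil_prefix, and_true] at h
        obtain ⟨rfl, rfl, rfl⟩ := h
        exact .inl ⟨[], l ++ [v], by simp⟩
    · rcases ih h with h | h | ⟨m, m', rfl, hc, hl⟩
      · exact .inl (h.trans (List.suffix_cons _ _).isInfix)
      · exact .inr (.inl h)
      · exact .inr (.inr ⟨w :: m, m', rfl, hc, hl⟩)

section Loops

variable {C : Finset V} {a b c v : V} {l l₁ l₂ l₃ m m' : List V}

/-- Unless one of the two old triples at `c` decides, the loop leaves `c` along an edge and comes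
back against one, so that `c` is an ancestor of a collider on the loop. -/
lemma isOpen_shortcut_triple
    (hadj : (m ++ a :: c :: (l ++ c :: b :: m')).IsChain (fun u v => D.Adj u v ∨ D.Adj v u))
    (hopen : D.IsOpen (m ++ a :: c :: (l ++ c :: b :: m')) C) :
    (D.IsCollider a c b → ∃ z ∈ C, D.IsAncestor c z) ∧ (¬ D.IsCollider a c b → c ∉ C) := by
  have hl : l ≠ [] := by
    rintro rfl
    have : List.IsChain _ [c, c] := hadj.infix ⟨m ++ [a], b :: m', by simp⟩
    simp only [List.isChain_cons_cons, or_self, List.isChain_singleton, and_true] at this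
    exact adj_ne this rfl
  obtain ⟨n, k, rfl⟩ := List.exists_cons_of_ne_nil hl
  obtain ⟨k', n', hk'⟩ := List.eq_nil_or_concat' (n :: k) |>.resolve_left hl
  have hloop : c :: n :: (k ++ [c]) <:+: m ++ a :: c :: (n :: k ++ c :: b :: m') :=
    ⟨m ++ [a], b :: m', by simp⟩
  have hcn : D.Adj c n ∨ D.Adj n c := (List.isChain_cons_cons.1 (hadj.infix hloop)).1
  have hnc : D.Adj n' c ∨ D.Adj c n' := by
    have : List.IsChain _ [n', c] := hadj.infix ⟨m ++ a :: c :: k', b :: m', by rw [hk']; simp⟩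
    simpa using this
  have hfst := hopen a c n ⟨m, k ++ c :: b :: m', by simp⟩
  have hlst := hopen n' c b ⟨m ++ a :: c :: k', m', by rw [hk']; simp⟩
  refine ⟨fun hc => ?_, fun hc => ?_⟩
  · rcases hcn with hcn | hcn
    · rcases hnc with hnc | hnc
      · exact hlst.1 ⟨hnc, hc.2⟩
      · exact IsOpen.exists_isAncestor (hadj.infix hloop) (hopen.of_infix hloop) hcn
          (m := c :: k') (a := n') (by rw [← List.cons_append, hk']; simp) hnc
    · exact hfst.1 ⟨hc.1, hcn⟩
  · by_cases hac : D.Adj a c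
    · exact hlst.2 fun h => hc ⟨hac, h.2⟩
    · exact hfst.2 fun h => hac h.1

lemma IsOpenWalk.shortcut (h : D.IsOpenWalk (l₁ ++ v :: (l₂ ++ v :: l₃)) a b C) :
    D.IsOpenWalk (l₁ ++ v :: l₃) a b C := by
  have hpre : l₁ ++ [v] <:+: l₁ ++ v :: (l₂ ++ v :: l₃) := ⟨[], l₂ ++ v :: l₃, by simp⟩
  have hsuf : v :: l₃ <:+: l₁ ++ v :: (l₂ ++ v :: l₃) := ⟨l₁ ++ v :: l₂, [], by simp⟩
  refine ⟨?_, ?_, ?_, fun a c b habc => ?_⟩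
  · simpa using List.IsChain.append_overlap (l₂ := [v]) (h.adjacent.infix hpre)
      (by simpa using h.adjacent.infix hsuf) (by simp)
  · have := h.head
    cases l₁ <;> simpa using this
  · have := h.last
    simp only [List.getLast?_append, List.getLast?_cons, Option.some_or] at this ⊢
    simpa using this
  · rcases triple_infix_append_cons habc with habc | habc | ⟨m, m', rfl, rfl, rfl⟩
    · exact h.isOpen a c b (habc.trans hpre)
    · exact h.isOpen a c b (habc.trans hsuf)
    · exact isOpen_shortcut_triple (m := m) (l := l₂) (m' := m') (by simpa using h.adjacent)
        (by simpa using h.isOpen)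

lemma IsOpenWalk.exists_isPath {p : List V} (h : D.IsOpenWalk p a b C) :
    ∃ q, D.IsPath q a b ∧ D.IsOpen q C := by
  induction hn : p.length using Nat.strong_induction_on generalizing p with
  | _ n ih =>
    by_cases hp : p.Nodup
    · exact ⟨p, ⟨hp, h.adjacent, h.head, h.last⟩, h.isOpen⟩
    · obtain ⟨v, hv⟩ := List.exists_duplicate_iff_not_nodup.2 hp
      obtain ⟨l₁, l₂, l₃, rfl⟩ : ∃ l₁ l₂ l₃, p = l₁ ++ v :: (l₂ ++ v :: l₃) := by
        rw [List.duplicate_iff_sublist, List.cons_sublist_iff] at hv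
        obtain ⟨r₁, r₂, rfl, hr₁, hr₂⟩ := hv
        obtain ⟨s, t, rfl⟩ := List.append_of_mem hr₁
        obtain ⟨s', t', rfl⟩ := List.append_of_mem (List.singleton_sublist.1 hr₂)
        exact ⟨s, t ++ s', t', by simp⟩
      exact ih _ (by simp only [List.length_append, List.length_cons] at hn ⊢; omega)
        h.shortcut rfl

lemma DSep.not_moralConn [Fintype V] [DecidableEq V] {S : Finset V}
    (h : D.DSep {a} {b} C) (hab : a ≠ b) (hS : S ⊆ D.ancestors (insert a (insert b C))) :
    ¬ D.MoralConn S C a b := by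
  intro hc
  rw [Finset.insert_comm] at hS
  obtain ⟨d, hd⟩ := hc.symm.exists_reach hab.symm hS
  obtain ⟨u, l, hw, -, -⟩ := hd.exists_isOpenWalk
  obtain ⟨q, hq, hq'⟩ := hw.exists_isPath
  exact h a (by simp) b (by simp) q hq hq'

end Loops

end DAG

/-! ### Marginal densities -/

section Marginals

variable {V : Type w} {Ω : V → Type u}

lemma dependsOn_finset_prod {ι : Type*} {f : ι → (∀ v, Ω v) → ℝ≥0∞} {s : Set V} {I : Finset ι}
    (hf : ∀ i ∈ I, DependsOn (f i) s) : DependsOn (fun v => ∏ i ∈ I, f i v) s :=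
  fun _ _ h => Finset.prod_congr rfl fun i hi => hf i hi h

variable [DecidableEq V] [∀ v, MeasurableSpace (Ω v)] {μ : ∀ v, Measure (Ω v)} {s t : Finset V}
  {f g : (∀ v, Ω v) → ℝ≥0∞}

lemma dependsOn_lmarginal (s : Finset V) (f : (∀ v, Ω v) → ℝ≥0∞) :
    DependsOn (∫⋯∫⁻_s, f ∂μ) (s : Set V)ᶜ :=
  fun _ _ h => lmarginal_congr μ f fun i hi => h i (by simpa using hi)

lemma dependsOn_lmarginal_of_dependsOn {t : Set V} (hf : DependsOn f t) :
    DependsOn (∫⋯∫⁻_s, f ∂μ) t := by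
  intro x y h
  refine lintegral_congr fun z => hf fun i hi => ?_
  by_cases his : i ∈ s <;> simp [Function.updateFinset, his, h i hi]

lemma dependsOn_marginalDensity [Fintype V] (f : (∀ v, Ω v) → ℝ≥0∞) (s : Finset V) :
    DependsOn (marginalDensity μ f s) (s : Set V) := by
  have := dependsOn_lmarginal (μ := μ) sᶜ f
  rwa [Finset.coe_compl, compl_compl] at this

lemma lmarginal_mul_left (hf : Measurable f) (hg : DependsOn g (s : Set V)ᶜ) :
    ∫⋯∫⁻_s, (fun v => g v * f v) ∂μ = fun v => g v * (∫⋯∫⁻_s, f ∂μ) v := by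
  funext x
  have hconst : ∀ z, g (Function.updateFinset x s z) = g x := fun z => hg fun i hi => by
    have : i ∉ s := by simpa using hi
    simp [Function.updateFinset, this]
  simp only [MeasureTheory.lmarginal, hconst]
  exact lintegral_const_mul _ (hf.comp measurable_updateFinset)

lemma lmarginal_indicator_one_eq_zero_iff {A : Set (∀ v, Ω v)} (hA : MeasurableSet A)
    (x : ∀ v, Ω v) :
    (∫⋯∫⁻_s, A.indicator 1 ∂μ) x = 0 ↔
      ∀ᵐ z ∂(Measure.pi fun i : s => μ i), Function.updateFinset x s z ∉ A := by
  have hm : Measurable fun z => A.indicator (1 : (∀ v, Ω v) → ℝ≥0∞)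
      (Function.updateFinset x s z) :=
    (measurable_one.indicator hA).comp measurable_updateFinset
  rw [MeasureTheory.lmarginal, lintegral_eq_zero_iff hm]
  refine Filter.eventually_congr (Filter.Eventually.of_forall fun z => ?_)
  simp

variable [∀ v, SigmaFinite (μ v)]

lemma lmarginal_union_mul (hst : Disjoint s t) (hf : Measurable f) (hg : Measurable g)
    (hft : DependsOn f (t : Set V)ᶜ) (hgs : DependsOn g (s : Set V)ᶜ) :
    ∫⋯∫⁻_(s ∪ t), (fun v => f v * g v) ∂μ =
      fun v => (∫⋯∫⁻_s, f ∂μ) v * (∫⋯∫⁻_t, g ∂μ) v := by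
  rw [lmarginal_union μ (fun v => f v * g v) (hf.mul hg) hst, lmarginal_mul_left hg hft]
  simpa only [mul_comm] using
    lmarginal_mul_left (μ := μ) hf (dependsOn_lmarginal_of_dependsOn (μ := μ) (s := t) hgs)

lemma lmarginal_lmarginal_of_subset (hf : Measurable f) (hst : s ⊆ t) :
    ∫⋯∫⁻_t, f ∂μ = ∫⋯∫⁻_(t \ s), ∫⋯∫⁻_s, f ∂μ ∂μ := by
  rw [← lmarginal_union μ f hf Finset.sdiff_disjoint, Finset.sdiff_union_of_subset hst]

lemma measurable_marginalDensity [Fintype V] (hf : Measurable f) (s : Finset V) :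
    Measurable (marginalDensity μ f s) :=
  hf.lmarginal μ

variable [Fintype V]

lemma lmarginal_lmarginal_compl (hf : Measurable f) (s : Finset V) :
    ∫⋯∫⁻_s, ∫⋯∫⁻_sᶜ, f ∂μ ∂μ = fun _ => ∫⁻ v, f v ∂(Measure.pi μ) := by
  rw [← lmarginal_union μ f hf disjoint_compl_right, Finset.union_compl, lmarginal_univ]

lemma ae_of_ae_updateFinset (s : Finset V) {p : (∀ v, Ω v) → Prop}
    (hp : MeasurableSet {v | p v})
    (h : ∀ x, ∀ᵐ z ∂(Measure.pi fun i : s => μ i), p (Function.updateFinset x s z)) :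
    ∀ᵐ v ∂(Measure.pi μ), p v := by
  rw [ae_iff]
  have hm : MeasurableSet {v | ¬ p v} := hp.compl
  rcases isEmpty_or_nonempty (∀ v, Ω v) with hE | ⟨⟨x⟩⟩
  · rw [Set.eq_empty_of_isEmpty {v | ¬ p v}, measure_empty]
  have h0 : ∫⋯∫⁻_s, (Set.indicator {v | ¬ p v} 1) ∂μ = fun _ => 0 := by
    funext x
    exact (lmarginal_indicator_one_eq_zero_iff hm x).2 (by simpa using h x)
  rw [← lintegral_indicator_one hm, lintegral_eq_lmarginal_univ x,
    lmarginal_lmarginal_of_subset (measurable_one.indicator hm) (Finset.subset_univ s), h0]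
  simp [MeasureTheory.lmarginal]

lemma ae_ae_updateFinset (s : Finset V) {p : (∀ v, Ω v) → Prop}
    (h : ∀ᵐ v ∂(Measure.pi μ), p v) :
    ∀ᵐ x ∂(Measure.pi μ), ∀ᵐ z ∂(Measure.pi fun i : s => μ i),
      p (Function.updateFinset x s z) := by
  obtain ⟨A, hpA, hA, hA0⟩ := exists_measurable_superset_of_null (ae_iff.1 h)
  have hm : Measurable (A.indicator (1 : (∀ v, Ω v) → ℝ≥0∞)) := measurable_one.indicator hA
  have hsection : ∀ᵐ x ∂(Measure.pi μ), (∫⋯∫⁻_s, (A.indicator 1) ∂μ) x = 0 := by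
    refine ae_of_ae_updateFinset sᶜ (measurableSet_eq_fun (hm.lmarginal μ) measurable_const) ?_
    intro x
    have h0 : (∫⋯∫⁻_sᶜ, (∫⋯∫⁻_s, (A.indicator 1) ∂μ) ∂μ) x = 0 := by
      have := lmarginal_lmarginal_compl (μ := μ) hm sᶜ
      rw [compl_compl] at this
      rw [this, lintegral_indicator_one hA, hA0]
    rwa [MeasureTheory.lmarginal, lintegral_eq_zero_iff] at h0
    exact (hm.lmarginal μ).comp measurable_updateFinset
  filter_upwards [hsection] with x hx
  filter_upwards [(lmarginal_indicator_one_eq_zero_iff hA x).1 hx] with z hz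
  by_contra hp
  exact hz (hpA hp)

lemma lmarginal_congr_ae (s : Finset V) (h : f =ᵐ[Measure.pi μ] g) :
    ∫⋯∫⁻_s, f ∂μ =ᵐ[Measure.pi μ] ∫⋯∫⁻_s, g ∂μ := by
  filter_upwards [ae_ae_updateFinset s h] with x hx
  exact lintegral_congr_ae hx

lemma marginalDensity_lt_top (hf : Measurable f) (h : ∫⁻ v, f v ∂(Measure.pi μ) ≠ ∞)
    (s : Finset V) : ∀ᵐ v ∂(Measure.pi μ), marginalDensity μ f s v < ∞ := by
  have hm := measurable_marginalDensity (μ := μ) hf s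
  refine ae_of_ae_updateFinset s (measurableSet_lt hm measurable_const) fun x => ?_
  refine ae_lt_top (hm.comp measurable_updateFinset) ?_
  change (∫⋯∫⁻_s, marginalDensity μ f s ∂μ) x ≠ ∞
  rw [marginalDensity, lmarginal_lmarginal_compl hf]
  exact h

lemma marginalDensity_pos (hf : Measurable f) (hpos : ∀ v, 0 < f v)
    (h : ∫⁻ v, f v ∂(Measure.pi μ) ≠ 0) (s : Finset V) (v : ∀ v, Ω v) :
    0 < marginalDensity μ f s v := by
  refine pos_iff_ne_zero.2 fun h0 => h ?_
  have hm : Measurable fun z => f (Function.updateFinset v sᶜ z) :=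
    hf.comp measurable_updateFinset
  rw [marginalDensity, MeasureTheory.lmarginal, lintegral_eq_zero_iff hm] at h0
  have hnull : (Measure.pi fun i : (sᶜ : Finset V) => μ i) Set.univ = 0 := by
    have : ∀ᵐ _ ∂(Measure.pi fun i : (sᶜ : Finset V) => μ i), False := by
      filter_upwards [h0] with _ hz
      exact (hpos _).ne' hz
    simpa [ae_iff] using this
  rw [Measure.pi_univ, Finset.prod_eq_zero_iff] at hnull
  obtain ⟨i, -, hi⟩ := hnull
  have : Measure.pi μ = 0 := by
    rw [← Measure.measure_univ_eq_zero, Measure.pi_univ]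
    exact Finset.prod_eq_zero (Finset.mem_univ (i : V)) hi
  simp [this]

end Marginals

lemma ennreal_mul_div_mul_mul_cancel {a b c d : ℝ≥0∞} (h0 : c * b ≠ 0) (h : c * b ≠ ∞) :
    a * b / (c * b) * (c * d) = a * d := by
  have hc0 : c ≠ 0 := left_ne_zero_of_mul h0
  have hb0 : b ≠ 0 := right_ne_zero_of_mul h0
  have hc : c ≠ ∞ := fun h' => by simp [h', hb0] at h
  have hb : b ≠ ∞ := fun h' => by simp [h', hc0] at h
  rw [ENNReal.mul_div_mul_right _ _ hb0 hb, ← mul_assoc, ENNReal.div_mul_cancel hc0 hc]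

/-! ### Products of kernels along a graph -/

namespace DAG

variable {V : Type w} {D : DAG V}

lemma exists_sink [Finite V] (D : DAG V) {B : Finset V} (hB : B.Nonempty) :
    ∃ b ∈ B, ∀ c ∈ B, ¬ D.Adj b c := by
  have : IsTrans V (fun a b => Relation.TransGen D.Adj b a) := ⟨fun a b c h h' => h'.trans h⟩
  have : Std.Irrefl (fun a b => Relation.TransGen D.Adj b a) := ⟨fun a => D.acyclic a⟩
  have wf : WellFounded (fun a b => Relation.TransGen D.Adj b a) :=
    Finite.wellFounded_of_trans_of_irrefl _
  obtain ⟨b, hb, hmin⟩ := wf.has_min (B : Set V) hB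
  exact ⟨b, hb, fun c hc hbc => hmin c hc (.single hbc)⟩

open Classical in
variable (D) in
/-- The nodes of `P` that lie in `U` or have a parent there: those whose kernels depend on a
coordinate in `U`. -/
noncomputable def touching (P U : Finset V) : Finset V :=
  P.filter fun v => ∃ u ∈ U, u = v ∨ D.Adj u v

lemma mem_touching {P U : Finset V} {v : V} :
    v ∈ D.touching P U ↔ v ∈ P ∧ ∃ u ∈ U, u = v ∨ D.Adj u v := by
  simp [touching]

variable [Fintype V]

lemma mem_parents {u v : V} : u ∈ D.parents v ↔ D.Adj u v := by
  simp [parents]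

lemma notMem_parents_self (v : V) : v ∉ D.parents v :=
  fun h => adj_ne (mem_parents.1 h) rfl

open Classical in
variable (D) in
/-- The nodes connected to `y` in the moral graph of `S` with `C` removed. -/
noncomputable def moralComponent (S C : Finset V) (y : V) : Finset V :=
  Finset.univ.filter fun u => D.MoralConn S C y u

lemma mem_moralComponent {S C : Finset V} {y u : V} :
    u ∈ D.moralComponent S C y ↔ D.MoralConn S C y u := by
  simp [moralComponent]

end DAG

section Kernels

variable {V : Type w} [DecidableEq V] {Ω : V → Type u} [∀ v, MeasurableSpace (Ω v)]

/-- A family of conditional densities of each node given its parents, normalized everywhere. -/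
structure IsKernelFamily (D : DAG V) (μ : ∀ v, Measure (Ω v)) (κ : V → (∀ v, Ω v) → ℝ≥0∞) :
    Prop where
  measurable : ∀ i, Measurable (κ i)
  dependsOn : ∀ i, DependsOn (κ i) {j | j = i ∨ D.Adj j i}
  lmarginal_eq_one : ∀ i v, (∫⋯∫⁻_{i}, κ i ∂μ) v = 1

variable {D : DAG V} {μ : ∀ v, Measure (Ω v)} {κ : V → (∀ v, Ω v) → ℝ≥0∞}

lemma IsKernelFamily.measurable_prod (hκ : IsKernelFamily D μ κ) (P : Finset V) :
    Measurable fun v => ∏ i ∈ P, κ i v :=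
  Finset.measurable_prod P fun i _ => hκ.measurable i

lemma IsKernelFamily.lmarginal_singleton_prod (hκ : IsKernelFamily D μ κ) {b : V} {P : Finset V}
    (hb : b ∈ P) (h : ∀ v ∈ P, ¬ D.Adj b v) :
    ∫⋯∫⁻_{b}, (fun v => ∏ i ∈ P, κ i v) ∂μ = fun v => ∏ i ∈ P.erase b, κ i v := by
  simp only [← Finset.prod_erase_mul P _ hb]
  rw [lmarginal_mul_left (hκ.measurable b)]
  · simp only [hκ.lmarginal_eq_one, mul_one]
  · refine dependsOn_finset_prod fun i hi => (hκ.dependsOn i).mono fun j hj => ?_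
    simp only [Finset.coe_singleton, Set.mem_compl_iff, Set.mem_singleton_iff]
    rintro rfl
    rcases hj with rfl | hj
    · exact Finset.notMem_erase _ _ hi
    · exact h i (Finset.mem_of_mem_erase hi) hj

variable [∀ v, SigmaFinite (μ v)]

lemma IsKernelFamily.lmarginal_prod [Finite V] (hκ : IsKernelFamily D μ κ) {B P : Finset V}
    (hBP : B ⊆ P) (h : ∀ v ∈ P \ B, ∀ b ∈ B, ¬ D.Adj b v) :
    ∫⋯∫⁻_B, (fun v => ∏ i ∈ P, κ i v) ∂μ = fun v => ∏ i ∈ P \ B, κ i v := by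
  induction B using Finset.strongInduction generalizing P with
  | H B ih =>
    rcases B.eq_empty_or_nonempty with rfl | hB
    · simp
    obtain ⟨b, hb, hsink⟩ := D.exists_sink hB
    have hset : P.erase b \ B.erase b = P \ B := by grind
    rw [lmarginal_lmarginal_of_subset (hκ.measurable_prod P) (Finset.singleton_subset_iff.2 hb),
      hκ.lmarginal_singleton_prod (hBP hb), Finset.sdiff_singleton_eq_erase,
      ih _ (Finset.erase_ssubset hb) (Finset.erase_subset_erase b hBP), hset]
    · rw [hset]
      exact fun v hv c hc => h v hv c (Finset.mem_of_mem_erase hc)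
    · intro v hv
      by_cases hvB : v ∈ B
      · exact hsink v hvB
      · exact h v (Finset.mem_sdiff.2 ⟨hv, hvB⟩) b hb

lemma IsKernelFamily.lmarginal_prod_of_parents_subset [Finite V]
    (hκ : IsKernelFamily D μ κ) {B P T : Finset V} (hTP : T ⊆ P) (hB : P \ T ⊆ B)
    (hT : ∀ v ∈ T, ∀ u ∈ P, D.Adj u v → u ∈ T) :
    ∫⋯∫⁻_B, (fun v => ∏ i ∈ P, κ i v) ∂μ =
      ∫⋯∫⁻_(B \ (P \ T)), (fun v => ∏ i ∈ T, κ i v) ∂μ := by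
  have hset : P \ (P \ T) = T := by rw [Finset.sdiff_sdiff_eq_self hTP]
  rw [lmarginal_lmarginal_of_subset (hκ.measurable_prod P) hB,
    hκ.lmarginal_prod Finset.sdiff_subset, hset]
  rw [hset]
  exact fun v hv b hb hbv => (Finset.mem_sdiff.1 hb).2 (hT v hv b (Finset.mem_sdiff.1 hb).1 hbv)

variable [Fintype V]

lemma IsKernelFamily.lintegral_prod (hκ : IsKernelFamily D μ κ) [hne : Nonempty (∀ v, Ω v)] :
    ∫⁻ v, ∏ i, κ i v ∂(Measure.pi μ) = 1 := by
  obtain ⟨x⟩ := hne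
  rw [lintegral_eq_lmarginal_univ x, hκ.lmarginal_prod subset_rfl (by simp)]
  simp

lemma IsKernelFamily.marginalDensity_prod (hκ : IsKernelFamily D μ κ) {A S : Finset V}
    (hA : A ⊆ S) (hS : ∀ v ∈ S, ∀ u, D.Adj u v → u ∈ S) :
    marginalDensity μ (fun v => ∏ i, κ i v) A = ∫⋯∫⁻_(S \ A), (fun v => ∏ i ∈ S, κ i v) ∂μ := by
  have hset : Aᶜ \ (Finset.univ \ S) = S \ A := by
    simp only [← Finset.compl_eq_univ_sdiff]
    grind [Finset.mem_compl]
  rw [marginalDensity, hκ.lmarginal_prod_of_parents_subset (Finset.subset_univ S)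
    (by grind [Finset.mem_compl]) (fun v hv u _ => hS v hv u), hset]

lemma IsKernelFamily.lmarginal_prod_eq_mul (hκ : IsKernelFamily D μ κ) {S C P B : Finset V}
    {y : V} (hy : y ∉ C) (hPS : P ⊆ S) (hBC : Disjoint B C) :
    ∫⋯∫⁻_B, (fun v => ∏ i ∈ P, κ i v) ∂μ = fun v =>
      (∫⋯∫⁻_(B ∩ D.moralComponent S C y),
        (fun v => ∏ i ∈ D.touching P (D.moralComponent S C y), κ i v) ∂μ) v *
      (∫⋯∫⁻_(B \ D.moralComponent S C y),
        (fun v => ∏ i ∈ P \ D.touching P (D.moralComponent S C y), κ i v) ∂μ) v := by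
  set U := D.moralComponent S C y
  have hfactor : (fun v => ∏ i ∈ P, κ i v) = fun v =>
      (∏ i ∈ D.touching P U, κ i v) * ∏ i ∈ P \ D.touching P U, κ i v := by
    funext v
    rw [mul_comm, Finset.prod_sdiff fun i hi => (DAG.mem_touching.1 hi).1]
  have hB : B = (B ∩ U) ∪ (B \ U) := by rw [Finset.union_comm, Finset.sdiff_union_inter]
  conv_lhs => rw [hB]
  rw [hfactor]
  refine lmarginal_union_mul (Finset.disjoint_sdiff_inter B U).symm
    (hκ.measurable_prod _) (hκ.measurable_prod _) ?_ ?_ <;>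
    refine dependsOn_finset_prod fun i hi => (hκ.dependsOn i).mono fun j hj => ?_
  · obtain ⟨hiP, u, hu, hui⟩ := DAG.mem_touching.1 hi
    simp only [Set.mem_compl_iff, Finset.mem_coe, Finset.mem_sdiff, not_and, not_not]
    intro hjB
    have hyu := DAG.mem_moralComponent.1 hu
    exact DAG.mem_moralComponent.2
      (hyu.tail ⟨hyu.notMem hy, Finset.disjoint_left.1 hBC hjB, i, hPS hiP, hui, hj⟩)
  · rw [Finset.mem_sdiff, DAG.mem_touching] at hi
    simp only [Set.mem_compl_iff, Finset.mem_coe, Finset.mem_inter, not_and]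
    exact fun _ hjU => hi.2 ⟨hi.1, j, hjU, hj⟩

lemma IsKernelFamily.marginalDensity_singleton_union_parents (hκ : IsKernelFamily D μ κ) (i : V) :
    marginalDensity μ (fun v => ∏ i, κ i v) ({i} ∪ D.parents i) = fun v =>
      κ i v * marginalDensity μ (fun v => ∏ i, κ i v) (D.parents i) v := by
  set S := D.ancestors (D.parents i)
  have hiS : i ∉ S := fun h => by
    obtain ⟨a, ha, hia⟩ := DAG.mem_ancestors.1 h
    exact DAG.not_isAncestor_of_adj (DAG.mem_parents.1 ha) hia
  have hpa : D.parents i ⊆ S := fun v hv => DAG.mem_ancestors_of_mem hv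
  have hS : ∀ v ∈ S, ∀ u, D.Adj u v → u ∈ S :=
    fun v hv u huv => DAG.mem_ancestors_of_isAncestor (.single huv) hv
  have hiS' : ∀ v ∈ insert i S, ∀ u, D.Adj u v → u ∈ insert i S := by
    intro v hv u huv
    rcases Finset.mem_insert.1 hv with rfl | hv
    · exact Finset.mem_insert_of_mem (hpa (DAG.mem_parents.2 huv))
    · exact Finset.mem_insert_of_mem (hS v hv u huv)
  have hset : insert i S \ ({i} ∪ D.parents i) = S \ D.parents i := by grind
  rw [hκ.marginalDensity_prod (by grind) hiS', hκ.marginalDensity_prod hpa hS, hset]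
  simp only [Finset.prod_insert hiS]
  refine lmarginal_mul_left (hκ.measurable_prod S) ((hκ.dependsOn i).mono fun j hj => ?_)
  rcases hj with rfl | hj
  · simp [hiS]
  · simp [DAG.mem_parents.2 hj]

lemma IsKernelFamily.isCompatible (hκ : IsKernelFamily D μ κ) [Nonempty (∀ v, Ω v)]
    (hpos : ∀ i v, 0 < κ i v) (hlt : ∀ i v, κ i v < ∞) :
    IsCompatible D μ fun X v => ∏ i ∈ Xᶜ, κ i v := by
  have hprod : (fun v => ∏ i ∈ (∅ : Finset V)ᶜ, κ i v) = fun v => ∏ i, κ i v := by simp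
  have hprod_pos : ∀ v, 0 < ∏ i, κ i v := fun v =>
    pos_iff_ne_zero.2 (Finset.prod_ne_zero_iff.2 fun i _ => (hpos i v).ne')
  refine ⟨fun X => hκ.measurable_prod _, by simpa using hprod_pos,
    fun v => ENNReal.prod_lt_top fun i _ => hlt i v, by simpa using hκ.lintegral_prod,
    fun X => ?_⟩
  have hfin : ∀ᵐ v ∂(Measure.pi μ), ∀ i,
      marginalDensity μ (fun v => ∏ i, κ i v) (D.parents i) v < ∞ :=
    ae_all_iff.2 fun i =>
      marginalDensity_lt_top (hκ.measurable_prod _) (by simp [hκ.lintegral_prod]) _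
  filter_upwards [hfin] with v hv
  refine Finset.prod_congr rfl fun i _ => ?_
  have hpa_pos := marginalDensity_pos (μ := μ) (hκ.measurable_prod _) hprod_pos
    (by simp [hκ.lintegral_prod]) (D.parents i) v
  rw [hprod, condDensity, hκ.marginalDensity_singleton_union_parents,
    ENNReal.mul_div_cancel_right hpa_pos.ne' (hv i).ne]

end Kernels

section ParentKernel

variable {V : Type w} [Fintype V] [DecidableEq V] {Ω : V → Type u} [∀ v, MeasurableSpace (Ω v)]
  {D : DAG V} {μ : ∀ v, Measure (Ω v)}

open Classical in
/-- A version of the conditional density `f(v_i | pa(v_i))` that is normalized everywhere: on the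
null set where `f(pa(v_i)) = ∞`, so that the quotient is meaningless, `f(v_i)` replaces it. -/
noncomputable def parentKernel (D : DAG V) (μ : ∀ v, Measure (Ω v)) (f : (∀ v, Ω v) → ℝ≥0∞)
    (i : V) (v : ∀ v, Ω v) : ℝ≥0∞ :=
  if marginalDensity μ f (D.parents i) v < ∞ then condDensity μ f {i} (D.parents i) v
  else marginalDensity μ f {i} v

variable [∀ v, SigmaFinite (μ v)] {f : (∀ v, Ω v) → ℝ≥0∞}

lemma lintegral_marginalDensity_update (hf : Measurable f) {i : V} {s : Finset V} (hi : i ∉ s)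
    (v : ∀ v, Ω v) :
    ∫⁻ z, marginalDensity μ f ({i} ∪ s) (Function.update v i z) ∂μ i = marginalDensity μ f s v := by
  have hset : {i} ∪ ({i} ∪ s)ᶜ = sᶜ := by grind [Finset.mem_compl]
  have hmarg := congrFun (lmarginal_singleton (μ := μ) (marginalDensity μ f ({i} ∪ s)) i) v
  rw [← hmarg, marginalDensity, marginalDensity, ← lmarginal_union μ _ hf (by simp), hset]

lemma isKernelFamily_parentKernel (D : DAG V) (hf : Measurable f) (hpos : ∀ v, 0 < f v)
    (hone : ∫⁻ v, f v ∂(Measure.pi μ) = 1) : IsKernelFamily D μ (parentKernel D μ f) := by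
  have hm : ∀ s, Measurable (marginalDensity μ f s) := measurable_marginalDensity hf
  have hdep : ∀ s : Finset V, DependsOn (marginalDensity μ f s) (s : Set V) :=
    dependsOn_marginalDensity f
  refine ⟨fun i => ?_, fun i x y h => ?_, fun i v => ?_⟩
  · exact Measurable.ite (measurableSet_lt (hm _) measurable_const) ((hm _).div (hm _)) (hm _)
  · have hpa := hdep (D.parents i) fun j hj => h j (.inr (DAG.mem_parents.1 hj))
    have hipa := hdep ({i} ∪ D.parents i) fun j hj => h j (by simpa [DAG.mem_parents] using hj)
    have hi := hdep {i} fun j hj => h j (.inl (by simpa using hj))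
    rw [parentKernel, parentKernel, condDensity, condDensity, hpa, hipa, hi]
  · have hpa : ∀ z, marginalDensity μ f (D.parents i) (Function.update v i z) =
        marginalDensity μ f (D.parents i) v := fun z => hdep _ fun j hj =>
      Function.update_of_ne (by rintro rfl; exact DAG.notMem_parents_self j hj) _ _
    rw [lmarginal_singleton]
    simp only [parentKernel, condDensity, hpa]
    split_ifs with hlt
    · simp only [div_eq_mul_inv]
      have hmi : Measurable fun z =>
          marginalDensity μ f ({i} ∪ D.parents i) (Function.update v i z) :=
        (hm _).comp (measurable_update v)
      rw [lintegral_mul_const _ hmi,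
        lintegral_marginalDensity_update hf (DAG.notMem_parents_self i)]
      exact ENNReal.mul_inv_cancel
        (marginalDensity_pos hf hpos (by simp [hone]) _ _).ne' hlt.ne
    · have := lintegral_marginalDensity_update (μ := μ) hf (Finset.notMem_empty i) v
      rw [Finset.union_empty] at this
      rw [this]
      simp [marginalDensity, hone]

lemma IsCompatible.exists_isKernelFamily {F : InterventionalFamily Ω} (hF : IsCompatible D μ F) :
    ∃ κ, IsKernelFamily D μ κ ∧ ∀ X, F X =ᵐ[Measure.pi μ] fun v => ∏ i ∈ Xᶜ, κ i v := by
  refine ⟨parentKernel D μ (F ∅),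
    isKernelFamily_parentKernel D (hF.measurable ∅) hF.pos hF.lintegral_eq_one, fun X => ?_⟩
  have hlt : ∀ᵐ v ∂(Measure.pi μ), ∀ i, marginalDensity μ (F ∅) (D.parents i) v < ∞ :=
    ae_all_iff.2 fun i =>
      marginalDensity_lt_top (hF.measurable ∅) (by simp [hF.lintegral_eq_one]) _
  filter_upwards [hF.truncated_factorization X, hlt] with v hv hvlt
  rw [hv]
  exact Finset.prod_congr rfl fun i _ => (if_pos (hvlt i)).symm

end ParentKernel

namespace DAG

/-- Pearl's back-door criterion for a set `X` of causes and an effect `y`: `Z` contains no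
descendant of `X`, and `X ∪ Z` separates the parents of `X` from `y` in the moral graph of the
ancestors. -/
structure SatisfiesBackdoor {V : Type w} [Fintype V] [DecidableEq V] (D : DAG V) (X : Finset V)
    (y : V) (Z : Finset V) : Prop where
  notMem_left : y ∉ X
  notMem_right : y ∉ Z
  not_isAncestor : ∀ x ∈ X, ∀ z ∈ Z, ¬ D.IsAncestor x z
  not_moralConn : ∀ x ∈ X, ∀ a, D.Adj a x →
    ¬ D.MoralConn (D.ancestors (X ∪ {y} ∪ Z)) (X ∪ Z) a y

end DAG

section Factorization

variable {V : Type w} [Fintype V] [DecidableEq V] {Ω : V → Type u} [∀ v, MeasurableSpace (Ω v)]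
  {D : DAG V} {μ : ∀ v, Measure (Ω v)} [∀ v, SigmaFinite (μ v)] {κ : V → (∀ v, Ω v) → ℝ≥0∞}

lemma IsKernelFamily.marginalDensity_ae_eq (hκ : IsKernelFamily D μ κ) {f : (∀ v, Ω v) → ℝ≥0∞}
    (hf : f =ᵐ[Measure.pi μ] fun v => ∏ i, κ i v) {A T : Finset V} (hA : A ⊆ D.ancestors T) :
    marginalDensity μ f A =ᵐ[Measure.pi μ]
      ∫⋯∫⁻_(D.ancestors T \ A), (fun v => ∏ i ∈ D.ancestors T, κ i v) ∂μ :=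
  (lmarginal_congr_ae Aᶜ hf).trans <| Filter.EventuallyEq.of_eq <|
    hκ.marginalDensity_prod hA fun _ hv _ huv => DAG.mem_ancestors_of_isAncestor (.single huv) hv

lemma IsKernelFamily.lmarginal_prod_compl (hκ : IsKernelFamily D μ κ) (X Z : Finset V) (y : V) :
    ∫⋯∫⁻_(X ∪ {y})ᶜ, (fun v => ∏ i ∈ Xᶜ, κ i v) ∂μ =
      ∫⋯∫⁻_(D.ancestors (X ∪ {y} ∪ Z) \ (X ∪ {y})),
        (fun v => ∏ i ∈ D.ancestors (X ∪ {y} ∪ Z) \ X, κ i v) ∂μ := by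
  set S := D.ancestors (X ∪ {y} ∪ Z)
  have hyS : y ∈ S := DAG.mem_ancestors_of_mem (by simp)
  have hset : (X ∪ {y})ᶜ \ (Xᶜ \ (S \ X)) = S \ (X ∪ {y}) := by grind [Finset.mem_compl]
  rw [hκ.lmarginal_prod_of_parents_subset (T := S \ X) (by grind [Finset.mem_compl])
    (by grind [Finset.mem_compl]), hset]
  intro v hv u hu huv
  exact Finset.mem_sdiff.2 ⟨DAG.mem_ancestors_of_isAncestor (.single huv) (Finset.mem_sdiff.1 hv).1,
    Finset.mem_compl.1 hu⟩

theorem IsCompatible.condIndepDensity {F : InterventionalFamily Ω} (hF : IsCompatible D μ F)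
    {a b : V} {C : Finset V} (hb : b ∉ C)
    (h : ¬ D.MoralConn (D.ancestors (insert a (insert b C))) C a b) :
    CondIndepDensity μ (F ∅) {a} {b} C := by
  obtain ⟨κ, hκ, hFκ⟩ := hF.exists_isKernelFamily
  set S := D.ancestors (insert a (insert b C))
  set U := D.moralComponent S C b
  have hbU : b ∈ U := DAG.mem_moralComponent.2 .refl
  have haU : a ∉ U := fun h' => h (DAG.mem_moralComponent.1 h').symm
  have hmarginal : ∀ A : Finset V, C ⊆ A → A ⊆ insert a (insert b C) →
      marginalDensity μ (F ∅) A =ᵐ[Measure.pi μ] fun v =>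
        (∫⋯∫⁻_((S \ A) ∩ U), (fun v => ∏ i ∈ D.touching S U, κ i v) ∂μ) v *
        (∫⋯∫⁻_((S \ A) \ U), (fun v => ∏ i ∈ S \ D.touching S U, κ i v) ∂μ) v := by
    intro A hCA hA
    rw [← hκ.lmarginal_prod_eq_mul hb subset_rfl (Finset.sdiff_disjoint.mono_right hCA)]
    exact hκ.marginalDensity_ae_eq (by simpa using hFκ ∅)
      fun v hv => DAG.mem_ancestors_of_mem (hA hv)
  filter_upwards [hmarginal ({a} ∪ {b} ∪ C) (by grind) (by grind),
    hmarginal C (by grind) (by grind), hmarginal ({a} ∪ C) (by grind) (by grind),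
    hmarginal ({b} ∪ C) (by grind) (by grind)] with v habC hC haC hbC
  have habU : (S \ ({a} ∪ {b} ∪ C)) ∩ U = (S \ ({b} ∪ C)) ∩ U := by grind
  have habU' : (S \ ({a} ∪ {b} ∪ C)) \ U = (S \ ({a} ∪ C)) \ U := by grind
  have haU' : (S \ ({a} ∪ C)) ∩ U = (S \ C) ∩ U := by grind
  have hbU' : (S \ ({b} ∪ C)) \ U = (S \ C) \ U := by grind
  rw [habC, hC, haC, hbC, habU, habU', haU', hbU']
  ring

namespace DAG.SatisfiesBackdoor

variable {X Z : Finset V} {y : V}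

lemma disjoint (h : D.SatisfiesBackdoor X y Z) : Disjoint X Z :=
  Finset.disjoint_left.2 fun x hx hz => h.not_isAncestor x hx x hz .refl

lemma marginalDensity_prod (h : D.SatisfiesBackdoor X y Z) (hκ : IsKernelFamily D μ κ) :
    marginalDensity μ (fun v => ∏ i, κ i v) Z =
      ∫⋯∫⁻_(D.ancestors (X ∪ {y} ∪ Z) \ (X ∪ Z)),
        (fun v => ∏ i ∈ D.ancestors (X ∪ {y} ∪ Z) \ X, κ i v) ∂μ := by
  set S := D.ancestors (X ∪ {y} ∪ Z)
  set T := D.ancestors Z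
  have hZT : Z ⊆ T := fun v hv => mem_ancestors_of_mem hv
  have hTS : T ⊆ S := ancestors_mono (by grind)
  have hTX : ∀ v ∈ T, v ∉ X := fun v hv hvX => by
    obtain ⟨z, hz, hvz⟩ := mem_ancestors.1 hv
    exact h.not_isAncestor v hvX z hz hvz
  have hset : (S \ (X ∪ Z)) \ ((S \ X) \ T) = T \ Z := by grind
  have hT : ∀ v ∈ T, ∀ u, D.Adj u v → u ∈ T :=
    fun v hv u huv => mem_ancestors_of_isAncestor (.single huv) hv
  rw [hκ.marginalDensity_prod hZT hT,
    hκ.lmarginal_prod_of_parents_subset (P := S \ X) (T := T) (by grind)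
    (by grind) (fun v hv u _ => hT v hv u), hset]

lemma touching_sdiff (h : D.SatisfiesBackdoor X y Z) :
    D.touching (D.ancestors (X ∪ {y} ∪ Z) \ X)
        (D.moralComponent (D.ancestors (X ∪ {y} ∪ Z)) (X ∪ Z) y) =
      D.touching (D.ancestors (X ∪ {y} ∪ Z))
        (D.moralComponent (D.ancestors (X ∪ {y} ∪ Z)) (X ∪ Z) y) := by
  have hy : y ∉ X ∪ Z := by simp [h.notMem_left, h.notMem_right]
  ext v
  simp only [mem_touching, Finset.mem_sdiff]
  refine ⟨fun hv => ⟨hv.1.1, hv.2⟩, fun hv => ⟨⟨hv.1, fun hvX => ?_⟩, hv.2⟩⟩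
  obtain ⟨u, hu, rfl | huv⟩ := hv.2
  · exact (mem_moralComponent.1 hu).notMem hy (Finset.mem_union_left Z hvX)
  · exact h.not_moralConn v hvX u huv (mem_moralComponent.1 hu).symm

/-- The kernels of `X` do not touch the moral component `U` of `y`, so dropping them changes only
the factor outside `U`, which is common to the numerator and the denominator of `f(y | x, z)`. -/
lemma condDensity_mul_marginalDensity (h : D.SatisfiesBackdoor X y Z)
    (hκ : IsKernelFamily D μ κ) {f : (∀ v, Ω v) → ℝ≥0∞} (hf : Measurable f) (hpos : ∀ v, 0 < f v)
    (hone : ∫⁻ v, f v ∂(Measure.pi μ) = 1) (hfκ : f =ᵐ[Measure.pi μ] fun v => ∏ i, κ i v) :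
    (fun v => condDensity μ f {y} (X ∪ Z) v * marginalDensity μ f Z v) =ᵐ[Measure.pi μ]
      ∫⋯∫⁻_(D.ancestors (X ∪ {y} ∪ Z) \ (X ∪ {y} ∪ Z)),
        (fun v => ∏ i ∈ D.ancestors (X ∪ {y} ∪ Z) \ X, κ i v) ∂μ := by
  set S := D.ancestors (X ∪ {y} ∪ Z) with hS
  set U := D.moralComponent S (X ∪ Z) y with hU
  have hsub : X ∪ {y} ∪ Z ⊆ S := fun v hv => mem_ancestors_of_mem hv
  have hy : y ∉ X ∪ Z := by simp [h.notMem_left, h.notMem_right]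
  have hyU : y ∈ U := mem_moralComponent.2 .refl
  have htouch : D.touching (S \ X) U = D.touching S U := h.touching_sdiff
  have hZ : marginalDensity μ f Z =ᵐ[Measure.pi μ]
      ∫⋯∫⁻_(S \ (X ∪ Z)), (fun v => ∏ i ∈ S \ X, κ i v) ∂μ :=
    (lmarginal_congr_ae _ hfκ).trans (.of_eq (h.marginalDensity_prod hκ))
  have hXZ_pos := marginalDensity_pos (μ := μ) hf hpos (by simp [hone]) (X ∪ Z)
  filter_upwards [hκ.marginalDensity_ae_eq hfκ (T := X ∪ {y} ∪ Z) (A := {y} ∪ (X ∪ Z)) (by grind),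
    hκ.marginalDensity_ae_eq hfκ (T := X ∪ {y} ∪ Z) (A := X ∪ Z) (by grind), hZ,
    marginalDensity_lt_top (μ := μ) hf (by simp [hone]) (X ∪ Z)] with v hyXZ hXZ hZ hlt
  have hne := (hXZ_pos v).ne'
  have hout : (S \ (X ∪ {y} ∪ Z)) \ U = (S \ (X ∪ Z)) \ U := by grind
  have hset : S \ ({y} ∪ (X ∪ Z)) = S \ (X ∪ {y} ∪ Z) := by grind
  have hdisj : Disjoint (S \ (X ∪ Z)) (X ∪ Z) := Finset.sdiff_disjoint
  have hdisj' : Disjoint (S \ (X ∪ {y} ∪ Z)) (X ∪ Z) := Finset.sdiff_disjoint.mono_right (by grind)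
  rw [condDensity, hyXZ, hXZ, hZ, ← hS, hset]
  rw [hXZ, hκ.lmarginal_prod_eq_mul hy subset_rfl hdisj] at hlt hne
  rw [hκ.lmarginal_prod_eq_mul hy subset_rfl hdisj, hκ.lmarginal_prod_eq_mul hy subset_rfl hdisj',
    hκ.lmarginal_prod_eq_mul (S := S) hy Finset.sdiff_subset hdisj,
    hκ.lmarginal_prod_eq_mul (S := S) hy Finset.sdiff_subset hdisj']
  simp only [← hS, ← hU, hout, htouch] at hlt hne ⊢
  exact ennreal_mul_div_mul_mul_cancel hne hlt.ne

theorem isAdjustmentSet (h : D.SatisfiesBackdoor X y Z) : IsAdjustmentSet.{u} D X {y} Z := by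
  refine ⟨⟨by simpa using h.notMem_left, h.disjoint, by simpa using h.notMem_right⟩, ?_⟩
  intro Ω _ μ _ F hF
  obtain ⟨κ, hκ, hFκ⟩ := hF.exists_isKernelFamily
  set S := D.ancestors (X ∪ {y} ∪ Z)
  have hset : S \ (X ∪ {y}) = Z ∪ (S \ (X ∪ {y} ∪ Z)) := by
    have hZS : ∀ z ∈ Z, z ∈ S := fun z hz => mem_ancestors_of_mem (by simp [hz])
    have hZX : ∀ z ∈ Z, z ∉ X := fun z hz hzX => Finset.disjoint_left.1 h.disjoint hzX hz
    have hyZ := h.notMem_right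
    grind
  have hdo : doDensity μ F X {y} =ᵐ[Measure.pi μ]
      ∫⋯∫⁻_Z, ∫⋯∫⁻_(S \ (X ∪ {y} ∪ Z)), (fun v => ∏ i ∈ S \ X, κ i v) ∂μ ∂μ := by
    rw [← lmarginal_union μ _ (hκ.measurable_prod _) (Finset.disjoint_sdiff.mono_left (by grind)),
      ← hset, ← hκ.lmarginal_prod_compl]
    exact lmarginal_congr_ae _ (hFκ X)
  exact hdo.trans (lmarginal_congr_ae Z (h.condDensity_mul_marginalDensity hκ (hF.measurable ∅)
    hF.pos hF.lintegral_eq_one (by simpa using hFκ ∅))).symm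

end DAG.SatisfiesBackdoor

end Factorization

/-! ### Densities on finite state spaces -/

section Counting

variable {V : Type w} {Ω : V → Type u} [∀ v, MeasurableSpace (Ω v)]

/-- The counting measures on the state spaces, as reference measures for finite models. -/
noncomputable abbrev countMeasure (Ω : V → Type u) [∀ v, MeasurableSpace (Ω v)] (v : V) :
    Measure (Ω v) :=
  Measure.count

lemma lmarginal_le_mul_measure_univ [DecidableEq V] {μ : ∀ v, Measure (Ω v)} {s : Finset V}
    {f : (∀ v, Ω v) → ℝ≥0∞} {c : ℝ≥0∞} {ω : ∀ v, Ω v}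
    (h : ∀ ω', (∀ v ∉ s, ω' v = ω v) → f ω' ≤ c) :
    (∫⋯∫⁻_s, f ∂μ) ω ≤ c * Measure.pi (fun v : s => μ v) Set.univ :=
  (lintegral_mono fun z => h _ fun v hv => by simp [Function.updateFinset, hv]).trans_eq
    (lintegral_const c)

variable [∀ v, Countable (Ω v)] [∀ v, MeasurableSingletonClass (Ω v)]

lemma pi_count_singleton [Fintype V] (ω : ∀ v, Ω v) :
    Measure.pi (countMeasure Ω) {ω} = 1 := by
  simp [countMeasure, Measure.pi_singleton]

lemma eq_of_ae_eq_pi_count [Fintype V] {α : Type*} {f g : (∀ v, Ω v) → α}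
    (h : f =ᵐ[Measure.pi (countMeasure Ω)] g) : f = g := by
  funext ω
  by_contra hne
  have := measure_mono_null (Set.singleton_subset_iff.2 hne) (ae_iff.1 h)
  simp at this

lemma le_lmarginal_count [DecidableEq V] (s : Finset V) (f : (∀ v, Ω v) → ℝ≥0∞) (ω : ∀ v, Ω v) :
    f ω ≤ (∫⋯∫⁻_s, f ∂(countMeasure Ω)) ω := by
  calc f ω = ∫⁻ z in {fun v : s => ω v}, f (Function.updateFinset ω s z)
        ∂(Measure.pi fun v : s => countMeasure Ω v) := by
        rw [lintegral_singleton, pi_count_singleton (Ω := fun v : s => Ω v), mul_one]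
        congr 1
        funext v
        simp [Function.updateFinset]
    _ ≤ _ := setLIntegral_le_lintegral _ _

lemma add_setLIntegral_le_lintegral_pi_count [Fintype V] (f : (∀ v, Ω v) → ℝ≥0∞)
    {A : Set (∀ v, Ω v)} {ω : ∀ v, Ω v} (hω : ω ∉ A) :
    f ω + ∫⁻ v in A, f v ∂(Measure.pi (countMeasure Ω)) ≤
      ∫⁻ v, f v ∂(Measure.pi (countMeasure Ω)) := by
  calc f ω + ∫⁻ v in A, f v ∂(Measure.pi (countMeasure Ω))
      = ∫⁻ v in {ω} ∪ A, f v ∂(Measure.pi (countMeasure Ω)) := by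
        rw [Set.union_comm, lintegral_union (measurableSet_singleton ω)
          (Set.disjoint_singleton_right.2 hω), lintegral_singleton, pi_count_singleton, mul_one,
          add_comm]
    _ ≤ _ := setLIntegral_le_lintegral _ _

lemma condDensity_count_le_one [Fintype V] [DecidableEq V] {f : (∀ v, Ω v) → ℝ≥0∞}
    (hf : Measurable f) (A B : Finset V) (ω : ∀ v, Ω v) :
    condDensity (countMeasure Ω) f A B ω ≤ 1 := by
  refine ENNReal.div_le_of_le_mul ?_
  rw [one_mul, marginalDensity, marginalDensity,
    lmarginal_lmarginal_of_subset (s := (A ∪ B)ᶜ) (t := Bᶜ) hf (by grind [Finset.mem_compl])]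
  exact le_lmarginal_count _ _ ω

end Counting

lemma adjustmentDensity_le {V : Type w} [Fintype V] [DecidableEq V] {Ω : V → Type u}
    [∀ v, MeasurableSpace (Ω v)] {μ : ∀ v, Measure (Ω v)} [∀ v, SigmaFinite (μ v)]
    {f g : (∀ v, Ω v) → ℝ≥0∞} (hf : Measurable f) (h1 : ∫⁻ v, f v ∂(Measure.pi μ) = 1)
    (hg : Measurable g) {X Y Z : Finset V} (hgZ : DependsOn g (Z : Set V)) {ε : ℝ≥0∞}
    {ω : ∀ v, Ω v}
    (h : ∀ ω', (∀ v ∉ Z, ω' v = ω v) → condDensity μ f Y (X ∪ Z) ω' ≤ g ω' + ε) :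
    adjustmentDensity μ f X Y Z ω ≤ ∫⁻ v, g v * f v ∂(Measure.pi μ) + ε := by
  have hm : Measurable fun v => (g v + ε) * f v := (hg.add_const ε).mul hf
  have hgZ' : DependsOn g ((Zᶜ : Finset V) : Set V)ᶜ := by simpa using hgZ
  calc adjustmentDensity μ f X Y Z ω
      ≤ (∫⋯∫⁻_Z, (fun v => (g v + ε) * marginalDensity μ f Z v) ∂μ) ω :=
        lintegral_mono fun z => mul_le_mul_left
          (h _ fun v hv => by simp [Function.updateFinset, hv]) _
    _ = (∫⋯∫⁻_Z, ∫⋯∫⁻_Zᶜ, (fun v => (g v + ε) * f v) ∂μ ∂μ) ω := by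
        rw [lmarginal_mul_left hf fun v w hvw => by rw [hgZ' hvw]]
        rfl
    _ = ∫⁻ v, (g v + ε) * f v ∂(Measure.pi μ) := by
        rw [lmarginal_lmarginal_compl hm]
    _ = ∫⁻ v, g v * f v ∂(Measure.pi μ) + ε := by
        simp only [add_mul]
        rw [lintegral_add_left (by fun_prop), lintegral_const_mul ε hf, h1, mul_one]

/-! ### Networks of noisy bits -/

lemma exists_noise_levels (M : ℕ) {K : ℝ≥0∞} (hK : K ≠ ∞) :
    ∃ δ η : ℝ≥0∞, 0 < δ ∧ δ ≤ η ∧ η ≤ 1 / 4 ∧ 3 / 4 ≤ (1 - η) ^ M ∧ δ * K ≤ η ^ M / 4 := by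
  have hquarter : (0 : ℝ≥0∞) < 1 / 4 := by simp
  have hpow : Filter.Tendsto (fun η : ℝ≥0∞ => (1 - η) ^ M) (nhds 0) (nhds 1) := by
    have : Continuous fun η : ℝ≥0∞ => (1 - η) ^ M :=
      (ENNReal.continuous_pow M).comp (ENNReal.continuous_sub_left ENNReal.one_ne_top)
    simpa using this.tendsto 0
  have hlt : (3 / 4 : ℝ≥0∞) < 1 := by
    rw [ENNReal.div_lt_iff (by simp) (by simp)]
    norm_num
  obtain ⟨η, ⟨hη, hη4⟩, hη0⟩ := ((((hpow.eventually_const_le hlt).and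
    (eventually_le_nhds hquarter)).filter_mono nhdsWithin_le_nhds).and
      (self_mem_nhdsWithin (s := Set.Ioi (0 : ℝ≥0∞)))).exists
  have hmul : Filter.Tendsto (fun δ : ℝ≥0∞ => δ * K) (nhds 0) (nhds 0) := by
    simpa using (ENNReal.continuous_mul_const hK).tendsto 0
  have hbound : 0 < η ^ M / 4 := ENNReal.div_pos (pow_ne_zero M (ne_of_gt hη0)) (by simp)
  obtain ⟨δ, ⟨hδ, hδη⟩, hδ0⟩ := ((((hmul.eventually_le_const hbound).and
    (eventually_le_nhds hη0)).filter_mono nhdsWithin_le_nhds).and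
      (self_mem_nhdsWithin (s := Set.Ioi (0 : ℝ≥0∞)))).exists
  exact ⟨δ, η, hδ0, hδη, hη4, hη, hδ⟩

/-- A causal model whose nodes carry bits, indexed by `J`: up to independent noise, the bit `j` at
the node `node j` is the function `eqn j` of the bits at the parents of that node. -/
structure BitNetwork {V : Type w} (D : DAG V) (J : Type u) where
  node : J → V
  eqn : J → (J → ZMod 2) → ZMod 2
  dependsOn_eqn : ∀ j, DependsOn (eqn j) {i | D.Adj (node i) (node j)}

/-- The weight of the noise `n` if its probability is `q`. -/
def noiseWeight (q : ℝ≥0∞) (n : ZMod 2) : ℝ≥0∞ := if n = 0 then 1 - q else q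

lemma sum_noiseWeight_add {q : ℝ≥0∞} (hq : q ≤ 1) (c : ZMod 2) :
    ∑ t, noiseWeight q (t + c) = 1 := by
  have huniv : (Finset.univ : Finset (ZMod 2)) = {0, 1} := by decide
  calc ∑ t, noiseWeight q (t + c)
      = ∑ t, noiseWeight q t := Equiv.sum_comp (Equiv.addRight c) (noiseWeight q)
    _ = 1 := by simp [huniv, noiseWeight, tsub_add_cancel_of_le hq]

namespace BitNetwork

variable {V : Type w} {D : DAG V} {J : Type u} (N : BitNetwork D J)

/-- The state of a node: the values of its bits. -/
abbrev State (v : V) : Type u := {j // N.node j = v} → ZMod 2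

/-- The values of all bits in a joint state. -/
def bits (ω : ∀ v, N.State v) (j : J) : ZMod 2 := ω (N.node j) ⟨j, rfl⟩

/-- The joint state with given values of all bits. -/
def ofBits (b : J → ZMod 2) (v : V) : N.State v := fun j => b j

/-- The deviation of the bit `j` from its structural equation. -/
def noise (ω : ∀ v, N.State v) (j : J) : ZMod 2 := N.bits ω j + N.eqn j (N.bits ω)

@[simp] lemma bits_ofBits (b : J → ZMod 2) : N.bits (N.ofBits b) = b := rfl

lemma bits_congr {ω ω' : ∀ v, N.State v} {j : J} (h : ω (N.node j) = ω' (N.node j)) :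
    N.bits ω j = N.bits ω' j :=
  congrFun h _

lemma noise_ofBits (b : J → ZMod 2) (j : J) : N.noise (N.ofBits b) j = b j + N.eqn j b := rfl

lemma eqn_bits_congr {ω ω' : ∀ v, N.State v} {j : J}
    (h : ∀ v, D.Adj v (N.node j) → ω v = ω' v) : N.eqn j (N.bits ω) = N.eqn j (N.bits ω') :=
  N.dependsOn_eqn j fun i hi => N.bits_congr (h (N.node i) hi)

variable [Fintype J] [DecidableEq V]

/-- The conditional density of a node given its parents when the bit `j` deviates from its
structural equation with probability `q j`. -/
noncomputable def kernel (q : J → ℝ≥0∞) (v : V) (ω : ∀ v, N.State v) : ℝ≥0∞ :=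
  ∏ j with N.node j = v, noiseWeight (q j) (N.noise ω j)

variable {q : J → ℝ≥0∞}

lemma lmarginal_kernel (hq : ∀ j, q j ≤ 1) (v : V) (ω : ∀ v, N.State v) :
    (∫⋯∫⁻_{v}, N.kernel q v ∂(countMeasure N.State)) ω = 1 := by
  classical
  have hnoise : ∀ (a : N.State v) (j : {j // N.node j = v}),
      N.noise (Function.update ω v a) j = a j + N.eqn j (N.bits ω) := by
    rintro a ⟨j, rfl⟩
    have hbit : N.bits (Function.update ω (N.node j) a) j = a ⟨j, rfl⟩ := by simp [bits]
    rw [noise, hbit, N.eqn_bits_congr fun u hu => Function.update_of_ne (DAG.adj_ne hu) a ω]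
  calc (∫⋯∫⁻_{v}, N.kernel q v ∂(countMeasure N.State)) ω
      = ∑ a : N.State v, ∏ j : {j // N.node j = v},
          noiseWeight (q j) (a j + N.eqn j (N.bits ω)) := by
        rw [lmarginal_singleton]
        refine (lintegral_count _).trans ((tsum_fintype _).trans ?_)
        refine Finset.sum_congr rfl fun a _ => ?_
        rw [kernel, Finset.prod_subtype (p := fun j => N.node j = v) _ (by simp)]
        exact Finset.prod_congr rfl fun j _ => by rw [hnoise]
    _ = ∏ j : {j // N.node j = v}, ∑ t, noiseWeight (q j) (t + N.eqn j (N.bits ω)) :=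
        ((Finset.prod_univ_sum _ _).trans (by rw [Fintype.piFinset_univ])).symm
    _ = 1 := Finset.prod_eq_one fun j _ => sum_noiseWeight_add (hq j) _

lemma isKernelFamily [Finite V] (hq : ∀ j, q j ≤ 1) :
    IsKernelFamily D (countMeasure N.State) (N.kernel q) where
  measurable _ := measurable_of_countable _
  dependsOn v ω ω' h := by
    refine Finset.prod_congr rfl fun j hj => ?_
    obtain rfl := (Finset.mem_filter.1 hj).2
    rw [noise, noise, N.bits_congr (h (N.node j) (.inl rfl)),
      N.eqn_bits_congr fun u hu => h u (.inr hu)]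
  lmarginal_eq_one := N.lmarginal_kernel hq

lemma isCompatible [Fintype V] (hq0 : ∀ j, 0 < q j) (hq1 : ∀ j, q j < 1) :
    IsCompatible D (countMeasure N.State) fun X ω => ∏ v ∈ Xᶜ, N.kernel q v ω := by
  have hweight : ∀ j n, 0 < noiseWeight (q j) n ∧ noiseWeight (q j) n < ∞ := by
    intro j n
    rw [noiseWeight]
    split_ifs
    · exact ⟨tsub_pos_of_lt (hq1 j), tsub_le_self.trans_lt ENNReal.one_lt_top⟩
    · exact ⟨hq0 j, (hq1 j).trans ENNReal.one_lt_top⟩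
  refine (N.isKernelFamily fun j => (hq1 j).le).isCompatible (fun v ω => ?_) fun v ω => ?_
  · exact pos_iff_ne_zero.2 (Finset.prod_ne_zero_iff.2 fun j _ => (hweight j _).1.ne')
  · exact ENNReal.prod_lt_top fun j _ => (hweight j _).2

lemma prod_kernel (A : Finset V) (ω : ∀ v, N.State v) :
    ∏ v ∈ A, N.kernel q v ω = ∏ j with N.node j ∈ A, noiseWeight (q j) (N.noise ω j) :=
  Finset.prod_fiberwise_eq_prod_filter _ _ _ _

lemma prod_kernel_le (hq : ∀ j, q j ≤ 1) {A : Finset V} {ω : ∀ v, N.State v} {j : J}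
    (hj : N.node j ∈ A) (h : N.noise ω j ≠ 0) : ∏ v ∈ A, N.kernel q v ω ≤ q j := by
  have hle : ∀ i n, noiseWeight (q i) n ≤ 1 := by
    intro i n
    rw [noiseWeight]
    split_ifs
    exacts [tsub_le_self, hq i]
  rw [prod_kernel]
  calc ∏ i with N.node i ∈ A, noiseWeight (q i) (N.noise ω i)
      ≤ ∏ i ∈ {j}, noiseWeight (q i) (N.noise ω i) :=
        Finset.prod_le_prod_of_subset_of_le_one' (by simpa using hj) fun i _ _ => hle i _
    _ = q j := by simp [noiseWeight, h]

lemma le_prod_kernel {c : ℝ≥0∞} (hc : c ≤ 1) {A : Finset V} {ω : ∀ v, N.State v}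
    (h : ∀ j, N.node j ∈ A → c ≤ noiseWeight (q j) (N.noise ω j)) :
    c ^ Fintype.card J ≤ ∏ v ∈ A, N.kernel q v ω := by
  rw [prod_kernel]
  refine (pow_le_pow_right_of_le_one' hc (Finset.card_le_univ _)).trans
    (Finset.pow_card_le_prod _ _ _ fun j hj => h j (by simpa using hj))

end BitNetwork

/-- A network of bits that detects a back-door path from `x` to `y` open given `Z`: as long as the
bits in `inner` are noiseless, the bit `dst` at `y` is the sum of the bit `src` at `x` and of a
`parity` of bits at `Z`, whereas setting `src` by intervention leaves all other bits unchanged. -/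
structure BackdoorNetwork {V : Type w} (D : DAG V) (x y : V) (Z : Finset V) (J : Type u)
    [DecidableEq J] extends BitNetwork D J where
  inner : Set J
  src : J
  dst : J
  parity : (J → ZMod 2) → ZMod 2
  node_eq_iff : ∀ j, node j = x ↔ j = src
  node_dst : node dst = y
  dependsOn_parity : DependsOn parity {j | node j ∈ Z}
  parity_zero : parity 0 = 0
  eqn_zero : ∀ j, eqn j 0 = 0
  eqn_single : ∀ j, eqn j (Pi.single src 1) = 0
  bit_dst : ∀ b : J → ZMod 2, (∀ j ∈ inner, b j + eqn j b = 0) → b dst = b src + parity b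
  exists_noiseless : ∀ b : J → ZMod 2, ∃ b' : J → ZMod 2,
    (∀ j, node j = x ∨ node j ∈ Z → b' j = b j) ∧ ∀ j ∈ inner, b' j + eqn j b' = 0

namespace BackdoorNetwork

variable {V : Type w} {D : DAG V} {x y : V} {Z : Finset V} {J : Type u} [DecidableEq J]
  (N : BackdoorNetwork D x y Z J)

open Classical in
/-- The noise probabilities: `δ` for the inner bits and `η` for the others. -/
noncomputable def noiseProb (δ η : ℝ≥0∞) (j : J) : ℝ≥0∞ := if j ∈ N.inner then δ else η

variable {δ η : ℝ≥0∞}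

lemma noiseProb_le (h : δ ≤ η) (j : J) : N.noiseProb δ η j ≤ η := by
  rw [noiseProb]
  split_ifs
  exacts [h, le_rfl]

section Densities

variable [Fintype V] [DecidableEq V] [Fintype J]

variable (δ η) in
/-- The interventional densities of the network with noise probabilities `δ` and `η`. -/
noncomputable def noisyFamily : InterventionalFamily N.State :=
  fun X ω => ∏ v ∈ Xᶜ, N.kernel (N.noiseProb δ η) v ω

lemma isCompatible_noisyFamily (hδ : 0 < δ) (hδη : δ ≤ η) (hη : η < 1) :
    IsCompatible D (countMeasure N.State) (N.noisyFamily δ η) :=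
  N.isCompatible
    (fun j => by rw [noiseProb]; split_ifs; exacts [hδ, hδ.trans_le hδη])
    fun j => (N.noiseProb_le hδη j).trans_lt hη

lemma pow_le_noisyFamily (h : δ ≤ η) {X : Finset V} {ω : ∀ v, N.State v}
    (hω : ∀ j, N.node j ∉ X → N.noise ω j = 0) :
    (1 - η) ^ Fintype.card J ≤ N.noisyFamily δ η X ω :=
  N.le_prod_kernel tsub_le_self fun j hj => by
    rw [noiseWeight, if_pos (hω j (by simpa using hj))]
    exact tsub_le_tsub_left (N.noiseProb_le h j) 1

lemma pow_le_doDensity (h : δ ≤ η) :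
    (1 - η) ^ Fintype.card J ≤ doDensity (countMeasure N.State) (N.noisyFamily δ η) {x} {y}
      (N.ofBits (Pi.single N.src 1)) := by
  refine le_trans (N.pow_le_noisyFamily h fun j hj => ?_) (le_lmarginal_count _ _ _)
  have hne : j ≠ N.src := by simpa [N.node_eq_iff] using hj
  rw [N.noise_ofBits, N.eqn_single j, Pi.single_eq_of_ne hne, add_zero]

lemma marginalDensity_noisyFamily_le (hδη : δ ≤ η) (hη : η ≤ 1) {ω : ∀ v, N.State v}
    (hdst : N.bits ω N.dst ≠ N.bits ω N.src) (hpar : N.parity (N.bits ω) = 0) :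
    marginalDensity (countMeasure N.State) (N.noisyFamily δ η ∅) ({y} ∪ ({x} ∪ Z)) ω ≤
      δ * Measure.pi (fun v : ↥({y} ∪ ({x} ∪ Z) : Finset V)ᶜ => countMeasure N.State v)
        Set.univ := by
  refine lmarginal_le_mul_measure_univ fun ω' hω' => ?_
  have hbit : ∀ j, N.node j ∈ ({y} ∪ ({x} ∪ Z) : Finset V) → N.bits ω' j = N.bits ω j :=
    fun j hj => N.bits_congr (hω' _ (Finset.notMem_compl.2 hj))
  have hpar' : N.parity (N.bits ω') = 0 :=
    (N.dependsOn_parity fun j hj => hbit j (by grind)).trans hpar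
  obtain ⟨j, hj, hnoise⟩ : ∃ j ∈ N.inner, N.noise ω' j ≠ 0 := by
    by_contra! hall
    have := N.bit_dst _ hall
    rw [hpar', add_zero, hbit N.dst (by simp [N.node_dst]),
      hbit N.src (by simp [(N.node_eq_iff _).2 rfl])] at this
    exact hdst this
  calc N.noisyFamily δ η ∅ ω' ≤ N.noiseProb δ η j :=
        N.prod_kernel_le (fun i => (N.noiseProb_le hδη i).trans hη) (by simp) hnoise
    _ = δ := if_pos hj

lemma pow_le_marginalDensity_noisyFamily (hδη : δ ≤ η) (hη : η ≤ 1 - η) (ω : ∀ v, N.State v) :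
    η ^ Fintype.card J ≤
      marginalDensity (countMeasure N.State) (N.noisyFamily δ η ∅) ({x} ∪ Z) ω := by
  obtain ⟨b, hb, hinner⟩ := N.exists_noiseless (N.bits ω)
  have hagree : ∀ v ∈ ({x} ∪ Z : Finset V), N.ofBits b v = ω v := by
    intro v hv
    funext ⟨j, hj⟩
    subst hj
    exact hb j (by simpa using hv)
  rw [← dependsOn_marginalDensity _ _ fun v hv => hagree v hv]
  refine le_trans (N.le_prod_kernel (hη.trans tsub_le_self) fun j _ => ?_)
    (le_lmarginal_count _ _ _)
  by_cases hj : j ∈ N.inner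
  · rw [N.noise_ofBits, hinner j hj, noiseWeight, if_pos rfl]
    exact hη.trans (tsub_le_tsub_left (N.noiseProb_le hδη j) 1)
  · rw [noiseWeight, noiseProb, if_neg hj]
    split_ifs
    exacts [hη, le_rfl]

lemma condDensity_noisyFamily_le (hδη : δ ≤ η) (hη0 : η ≠ 0) (hη : η ≤ 1 - η)
    (hK : δ * Measure.pi (fun v : ↥({y} ∪ ({x} ∪ Z) : Finset V)ᶜ => countMeasure N.State v)
      Set.univ ≤ η ^ Fintype.card J / 4) {ω : ∀ v, N.State v}
    (hdst : N.bits ω N.dst ≠ N.bits ω N.src) (hpar : N.parity (N.bits ω) = 0) :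
    condDensity (countMeasure N.State) (N.noisyFamily δ η ∅) {y} ({x} ∪ Z) ω ≤ 1 / 4 := by
  have hη1 : η ≤ 1 := hη.trans tsub_le_self
  have hηtop : η ≠ ∞ := ne_top_of_le_ne_top ENNReal.one_ne_top hη1
  calc condDensity (countMeasure N.State) (N.noisyFamily δ η ∅) {y} ({x} ∪ Z) ω
      ≤ (η ^ Fintype.card J / 4) / η ^ Fintype.card J :=
        ENNReal.div_le_div ((N.marginalDensity_noisyFamily_le hδη hη1 hdst hpar).trans hK)
          (N.pow_le_marginalDensity_noisyFamily hδη hη ω)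
    _ = 1 / 4 := by
        rw [ENNReal.div_right_comm, ENNReal.div_self (pow_ne_zero _ hη0) (ENNReal.pow_ne_top hηtop)]

lemma lintegral_indicator_mul_noisyFamily_le (hδη : δ ≤ η)
    (h1 : ∫⁻ ω, N.noisyFamily δ η ∅ ω ∂(Measure.pi (countMeasure N.State)) = 1)
    (hpow : 3 / 4 ≤ (1 - η) ^ Fintype.card J) :
    ∫⁻ ω, {ω | N.parity (N.bits ω) ≠ 0}.indicator 1 ω * N.noisyFamily δ η ∅ ω
      ∂(Measure.pi (countMeasure N.State)) ≤ 1 / 4 := by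
  set A := {ω : ∀ v, N.State v | N.parity (N.bits ω) ≠ 0}
  have h0 : N.ofBits 0 ∉ A := by simp [A, N.parity_zero]
  have hle : 3 / 4 ≤ N.noisyFamily δ η ∅ (N.ofBits 0) :=
    hpow.trans (N.pow_le_noisyFamily hδη fun j _ => by simp [N.noise_ofBits, N.eqn_zero])
  have hind : ∀ ω, A.indicator (1 : (∀ v, N.State v) → ℝ≥0∞) ω * N.noisyFamily δ η ∅ ω =
      A.indicator (N.noisyFamily δ η ∅) ω := by
    intro ω
    by_cases hω : ω ∈ A <;> simp [hω]
  simp only [hind]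
  rw [lintegral_indicator (Set.to_countable A).measurableSet]
  have hsum := (add_le_add_left hle _).trans (add_setLIntegral_le_lintegral_pi_count
    (N.noisyFamily δ η ∅) h0)
  rw [h1] at hsum
  refine ENNReal.le_of_add_le_add_left (a := 3 / 4) (by finiteness) (hsum.trans_eq ?_)
  rw [ENNReal.div_add_div_same]
  norm_num [ENNReal.div_self]

lemma condDensity_le_indicator_add (hcompat : IsCompatible D (countMeasure N.State)
      (N.noisyFamily δ η)) (hxy : x ≠ y) (hx : x ∉ Z) (hy : y ∉ Z)
    (hδη : δ ≤ η) (hη0 : η ≠ 0) (hη : η ≤ 1 - η)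
    (hK : δ * Measure.pi (fun v : ↥({y} ∪ ({x} ∪ Z) : Finset V)ᶜ => countMeasure N.State v)
      Set.univ ≤ η ^ Fintype.card J / 4) {ω : ∀ v, N.State v}
    (hω : ∀ v ∉ Z, ω v = N.ofBits (Pi.single N.src 1) v) :
    condDensity (countMeasure N.State) (N.noisyFamily δ η ∅) {y} ({x} ∪ Z) ω ≤
      {ω | N.parity (N.bits ω) ≠ 0}.indicator 1 ω + 1 / 4 := by
  have hsrc : N.node N.src = x := (N.node_eq_iff _).2 rfl
  have hdst : N.dst ≠ N.src := fun h =>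
    hxy (hsrc.symm.trans ((congrArg N.node h.symm).trans N.node_dst))
  by_cases hpar : N.parity (N.bits ω) = 0
  · refine (N.condDensity_noisyFamily_le hδη hη0 hη hK ?_ hpar).trans le_add_self
    rw [N.bits_congr (hω _ (by rwa [N.node_dst])), N.bits_congr (hω _ (by rwa [hsrc]))]
    simp [hdst]
  · rw [Set.indicator_of_mem (by exact hpar)]
    exact (condDensity_count_le_one (hcompat.measurable ∅) _ _ _).trans le_self_add

end Densities

variable [Fintype V] [DecidableEq V]

/-- The bit at `y` differs from the bit at `x` under the intervention, but agrees with it given the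
likely even parity of the bits at `Z`. -/
theorem not_isAdjustmentSet [Finite J] (N : BackdoorNetwork D x y Z J) :
    ¬ IsAdjustmentSet.{u} D {x} {y} Z := by
  rintro ⟨⟨hxy, hx, hy⟩, hadj⟩
  have := Fintype.ofFinite J
  obtain ⟨δ, η, hδ0, hδη, hη4, hpow, hK⟩ := exists_noise_levels (Fintype.card J)
    (measure_ne_top (Measure.pi fun v : ↥({y} ∪ ({x} ∪ Z) : Finset V)ᶜ => countMeasure N.State v)
      Set.univ)
  have hη1 : η < 1 := hη4.trans_lt (by rw [ENNReal.div_lt_iff] <;> norm_num)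
  have hη : η ≤ 1 - η := by
    refine ENNReal.le_sub_of_add_le_right hη1.ne_top ((add_le_add hη4 hη4).trans ?_)
    rw [ENNReal.div_add_div_same]
    exact ENNReal.div_le_of_le_mul (by norm_num)
  have hcompat := N.isCompatible_noisyFamily hδ0 hδη hη1
  have hdep : DependsOn ({ω | N.parity (N.bits ω) ≠ 0}.indicator (1 : (∀ v, N.State v) → ℝ≥0∞))
      (Z : Set V) := by
    intro ω ω' h
    have := N.dependsOn_parity fun j hj => N.bits_congr (h _ hj)
    simp [Set.indicator, this]
  have hle : (3 / 4 : ℝ≥0∞) ≤ 1 / 4 + 1 / 4 :=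
    calc 3 / 4 ≤ doDensity (countMeasure N.State) (N.noisyFamily δ η) {x} {y}
            (N.ofBits (Pi.single N.src 1)) :=
          hpow.trans (N.pow_le_doDensity hδη)
      _ = adjustmentDensity (countMeasure N.State) (N.noisyFamily δ η ∅) {x} {y} Z _ :=
          congrFun (eq_of_ae_eq_pi_count (hadj N.State _ _ hcompat)) _
      _ ≤ _ := adjustmentDensity_le (hcompat.measurable ∅) hcompat.lintegral_eq_one
          (measurable_of_countable _) hdep fun ω =>
            N.condDensity_le_indicator_add hcompat (by simpa using hxy) (by simpa using hx)
              (by simpa using hy) hδη (hδ0.trans_le hδη).ne' hη hK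
      _ ≤ 1 / 4 + 1 / 4 := add_le_add_left
          (N.lintegral_indicator_mul_noisyFamily_le hδη hcompat.lintegral_eq_one hpow) _
  rw [ENNReal.div_add_div_same, ENNReal.div_le_iff (by simp) (by simp),
    ENNReal.div_mul_cancel (by simp) (by simp)] at hle
  norm_num at hle

end BackdoorNetwork

/-! ### Back-door walks -/

namespace DAG

variable {V : Type w}

/-- A walk `p 0, …, p N` from `x`, whose edge between `p i` and `p (i + 1)` points to the latter
if `e i` holds. It starts against an edge into `x`, its later nodes differ from `x`, and its inner
nodes are colliders exactly if they lie in `Z`. -/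
structure IsBackdoorWalk (D : DAG V) (x : V) (Z : Finset V) (N : ℕ) (p : ℕ → V) (e : ℕ → Bool) :
    Prop where
  start : p 0 = x
  first : e 0 = false
  forward : ∀ i < N, e i = true → D.Adj (p i) (p (i + 1))
  backward : ∀ i < N, e i = false → D.Adj (p (i + 1)) (p i)
  ne_start : ∀ i < N, p (i + 1) ≠ x
  mem_iff : ∀ i, i + 1 < N → (p (i + 1) ∈ Z ↔ e i = true ∧ e (i + 1) = false)

variable {D : DAG V} {x y : V} {Z : Finset V} {N : ℕ} {p : ℕ → V} {e : ℕ → Bool}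

lemma IsBackdoorWalk.extend {v : V} {d : Bool} (h : D.IsBackdoorWalk x Z (N + 1) p e)
    (hv : v ≠ x) (hf : d = true → D.Adj (p (N + 1)) v) (hb : d = false → D.Adj v (p (N + 1)))
    (hZ : p (N + 1) ∈ Z ↔ e N = true ∧ d = false) :
    D.IsBackdoorWalk x Z (N + 2) (fun i => if i ≤ N + 1 then p i else v)
      (fun i => if i ≤ N then e i else d) := by
  have hsplit : ∀ i < N + 2, i < N + 1 ∨ i = N + 1 := fun i hi => by omega
  refine ⟨by simp [h.start], by simp [h.first], fun i hi => ?_, fun i hi => ?_, fun i hi => ?_,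
    fun i hi => ?_⟩
  · rcases hsplit i hi with hi | rfl
    · simpa [show i ≤ N + 1 by omega, show i ≤ N by omega] using h.forward i hi
    · simpa using hf
  · rcases hsplit i hi with hi | rfl
    · simpa [show i ≤ N + 1 by omega, show i ≤ N by omega] using h.backward i hi
    · simpa using hb
  · rcases hsplit i hi with hi | rfl
    · simpa [show i ≤ N by omega] using h.ne_start i hi
    · simpa using hv
  · rcases hsplit (i + 1) hi with hi | hi
    · simpa [show i ≤ N by omega, show i + 1 ≤ N by omega] using h.mem_iff i hi
    · obtain rfl : i = N := by omega
      simpa using hZ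

lemma Reach.exists_isBackdoorWalk {v : V} {d : Bool} (h : D.Reach x y Z False v d) :
    ∃ (N : ℕ) (p : ℕ → V) (e : ℕ → Bool), D.IsBackdoorWalk x Z (N + 1) p e ∧ p (N + 1) = v ∧
      e N = d := by
  induction h with
  | @start v h =>
    refine ⟨0, fun i => if i = 0 then x else v, fun _ => false,
      ⟨by simp, rfl, by simp, fun i hi => ?_, fun _ _ => ?_, ?_⟩, by simp, rfl⟩
    · simpa [Nat.lt_one_iff.1 hi] using h
    · simpa using adj_ne h
    · intro i hi
      omega
  | startOut h => exact h.elim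
  | @down u v d _ hu huy huv hv ih =>
    obtain ⟨N, p, e, hw, rfl, rfl⟩ := ih
    exact ⟨N + 1, _, _, hw.extend (v := v) (d := true) hv (fun _ => huv) (by simp)
      (by simp [hu]), by simp, by simp⟩
  | @up u v _ hu huy huv hv ih =>
    obtain ⟨N, p, e, hw, rfl, he⟩ := ih
    exact ⟨N + 1, _, _, hw.extend (v := v) (d := false) hv (by simp) (fun _ => huv)
      (by simp [hu, he]), by simp, by simp⟩
  | @bounce u v _ hu huy huv hv ih =>
    obtain ⟨N, p, e, hw, rfl, he⟩ := ih
    exact ⟨N + 1, _, _, hw.extend (v := v) (d := false) hv (by simp) (fun _ => huv)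
      (by simp [hu, he]), by simp, by simp⟩

namespace IsBackdoorWalk

lemma notMem_of_forward (hw : D.IsBackdoorWalk x Z N p e) {i : ℕ} (hi : i < N)
    (he : e i = true) : p i ∉ Z := by
  rcases i with _ | i
  · simp [hw.first] at he
  · simp [hw.mem_iff i hi, he]

lemma notMem_of_backward (hw : D.IsBackdoorWalk x Z N p e) (hN : p N ∉ Z) {i : ℕ} (hi : i < N)
    (he : e i = false) : p (i + 1) ∉ Z := by
  rcases (show i + 1 ≤ N from hi).eq_or_lt with rfl | hi
  · exact hN
  · simp [hw.mem_iff i hi, he]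

end IsBackdoorWalk

/-- The sum of the bits at the parents of position `j` on the walk. -/
def parentSum (N : ℕ) (e : ℕ → Bool) (c : ℕ → ZMod 2) (j : ℕ) : ZMod 2 :=
  (if 0 < j ∧ e (j - 1) = true then c (j - 1) else 0) +
    if j < N ∧ e j = false then c (j + 1) else 0

/-- Position `j` has a parent on the walk. -/
def HasParent (N : ℕ) (e : ℕ → Bool) (j : ℕ) : Prop :=
  (0 < j ∧ e (j - 1) = true) ∨ (j < N ∧ e j = false)

/-- The sum of the bits at the colliders up to position `n`. -/
def colliderSum [DecidableEq V] (p : ℕ → V) (Z : Finset V) (c : ℕ → ZMod 2) (n : ℕ) : ZMod 2 :=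
  ∑ i ∈ Finset.range n, if p (i + 1) ∈ Z then c (i + 1) else 0

namespace IsBackdoorWalk

lemma parentSum_congr (hw : D.IsBackdoorWalk x Z N p e) {c c' : ℕ → ZMod 2} {j : ℕ} (hj : j ≤ N)
    (h : ∀ i ≤ N, D.Adj (p i) (p j) → c i = c' i) : parentSum N e c j = parentSum N e c' j := by
  refine congrArg₂ (· + ·) (ite_congr rfl (fun hpar => ?_) fun _ => rfl)
    (ite_congr rfl (fun hpar => ?_) fun _ => rfl)
  · have hadj := hw.forward (j - 1) (by omega) hpar.2
    rw [Nat.sub_add_cancel hpar.1] at hadj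
    exact h _ (by omega) hadj
  · exact h _ hpar.1 (hw.backward j hpar.1 hpar.2)

lemma parentSum_eq_zero (hw : D.IsBackdoorWalk x Z N p e) {c : ℕ → ZMod 2}
    (hc : ∀ i ≤ N, i ≠ 0 → c i = 0) {j : ℕ} (hj : j ≤ N) : parentSum N e c j = 0 := by
  have hprev : 0 < j ∧ e (j - 1) = true → c (j - 1) = 0 := fun h =>
    hc _ (by omega) fun h0 => by simp [h0, hw.first] at h
  have hnext : j < N ∧ e j = false → c (j + 1) = 0 := fun h => hc _ h.1 j.succ_ne_zero
  rw [parentSum, ite_eq_right_iff.2 hprev, ite_eq_right_iff.2 hnext, add_zero]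

variable [DecidableEq V] {c c' : ℕ → ZMod 2}

/-- Without noise, the parent of each edge carries the sum of the first bit and of the bits at the
colliders before the edge. -/
lemma bit_eq_add_colliderSum (hw : D.IsBackdoorWalk x Z N p e) (hN : p N ∉ Z)
    (hc : ∀ j ≤ N, HasParent N e j → c j = parentSum N e c j) :
    c N = c 0 + colliderSum p Z c N := by
  have htail : ∀ i < N, (if e i = true then c i else c (i + 1)) = c 0 + colliderSum p Z c i := by
    intro i hi
    induction i with
    | zero => simpa [colliderSum, parentSum, hw.first, hi] using
        (hc 0 hi.le (.inr ⟨hi, hw.first⟩)).symm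
    | succ i ih =>
      have hm := hw.mem_iff i hi
      have hci := hc (i + 1) hi.le
      rw [colliderSum, Finset.sum_range_succ, ← add_assoc, ← colliderSum, ← ih (by omega)]
      cases he : e i <;> cases he' : e (i + 1)
      · simp [hm, he, hci (.inr ⟨hi, he'⟩), parentSum, he', hi]
      · simp [hm, he, he']
      · simp [hm, hci (.inr ⟨hi, he'⟩), parentSum, he, he', hi, ← add_assoc,
          CharTwo.add_self_eq_zero]
      · simp [hm, he, he', hci (.inl ⟨i.succ_pos, he⟩), parentSum]
  rcases N with _ | n
  · simp [colliderSum]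
  rw [colliderSum, Finset.sum_range_succ, if_neg hN, add_zero, ← colliderSum, ← htail n (by omega)]
  cases hen : e n
  · simp
  · simpa [parentSum, hen] using hc (n + 1) le_rfl (.inl (by simpa using hen))

lemma eq_parentSum (hw : D.IsBackdoorWalk x Z N p e) (hx : x ∉ Z) (hN : p N ∉ Z)
    (hc' : ∀ j ≤ N, c' j = if p j ∈ Z then c j else c 0 + colliderSum p Z c j) {j : ℕ}
    (hj : j ≤ N) (h : HasParent N e j) : c' j = parentSum N e c' j := by
  have hfwd : ∀ i < N, e i = true → c' i = c 0 + colliderSum p Z c i := fun i hi he => by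
    rw [hc' i hi.le, if_neg (hw.notMem_of_forward hi he)]
  have hbwd : ∀ i < N, e i = false → c' (i + 1) = c 0 + colliderSum p Z c i := fun i hi he => by
    have hmem := hw.notMem_of_backward hN hi he
    rw [hc' (i + 1) hi, if_neg hmem, colliderSum, Finset.sum_range_succ, if_neg hmem, add_zero,
      ← colliderSum]
  rcases j with _ | j
  · obtain ⟨h0, he⟩ : 0 < N ∧ e 0 = false := by simpa [HasParent] using h
    simp [parentSum, h0, he, hbwd 0 h0 he, hc', hw.start, hx]
  have hsucc : colliderSum p Z c (j + 1) =
      colliderSum p Z c j + if p (j + 1) ∈ Z then c (j + 1) else 0 :=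
    Finset.sum_range_succ _ _
  rcases hj.eq_or_lt with rfl | hj'
  · have he : e j = true := by simpa [HasParent] using h
    simp [parentSum, he, hfwd j hj he, hc', hsucc, hN]
  have hm := hw.mem_iff j hj'
  cases he : e j <;> cases he' : e (j + 1)
  · simp [parentSum, he, he', hj', hbwd (j + 1) hj' he', hc' _ hj, hm]
  · simp [HasParent, he, he'] at h
  · simp [parentSum, he, he', hj', hfwd j hj he, hbwd (j + 1) hj' he', hc' _ hj, hm, hsucc,
      ← add_assoc, CharTwo.add_self_eq_zero]
  · simp [parentSum, he, he', hfwd j hj he, hc' _ hj, hm, hsucc]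

end IsBackdoorWalk

section Network

/-- The index of position `i ≤ N` of a walk, in the universe of the state spaces. -/
def walkIndex (N i : ℕ) : ULift.{u} (Fin (N + 1)) := ⟨Fin.ofNat (N + 1) i⟩

lemma down_walkIndex {i : ℕ} (hi : i ≤ N) : ((walkIndex.{u} N i).down : ℕ) = i :=
  Nat.mod_eq_of_lt (Nat.lt_succ_of_le hi)

lemma walkIndex_down (j : ULift.{u} (Fin (N + 1))) : walkIndex N j.down = j :=
  ULift.down_injective (Fin.ext (down_walkIndex (Nat.le_of_lt_succ j.down.2)))

/-- The sequence of bits along the walk. -/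
def walkBits {N : ℕ} (b : ULift.{u} (Fin (N + 1)) → ZMod 2) (i : ℕ) : ZMod 2 := b (walkIndex N i)

namespace IsBackdoorWalk

lemma apply_eq_iff (hw : D.IsBackdoorWalk x Z N p e) (j : ULift.{u} (Fin (N + 1))) :
    p j.down = x ↔ j = walkIndex N 0 := by
  constructor
  · intro h
    rw [← walkIndex_down j]
    rcases hj : (j.down : ℕ) with _ | i
    · rfl
    · exact absurd (hj ▸ h) (hw.ne_start i (by omega))
  · rintro rfl
    rw [down_walkIndex (Nat.zero_le N), hw.start]

lemma parentSum_single (hw : D.IsBackdoorWalk x Z N p e) (j : ULift.{u} (Fin (N + 1))) :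
    parentSum N e (walkBits (Pi.single (walkIndex.{u} N 0) 1)) j.down = 0 := by
  refine hw.parentSum_eq_zero (fun i hi h0 => ?_) (Nat.le_of_lt_succ j.down.2)
  rw [walkBits, Pi.single_eq_of_ne]
  refine fun h => h0 ?_
  rw [← down_walkIndex.{u} hi, h, down_walkIndex (Nat.zero_le N)]

lemma dependsOn_parentSum (hw : D.IsBackdoorWalk x Z N p e) (j : ULift.{u} (Fin (N + 1))) :
    DependsOn (fun b : ULift.{u} (Fin (N + 1)) → ZMod 2 => parentSum N e (walkBits b) j.down)
      {i | D.Adj (p i.down) (p j.down)} := fun b b' h =>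
  hw.parentSum_congr (Nat.le_of_lt_succ j.down.2) fun i hi hadj =>
    h (walkIndex N i) (by simpa [down_walkIndex hi] using hadj)

lemma exists_noiseless (hw : D.IsBackdoorWalk x Z N p e) (hx : x ∉ Z) (hN : p N ∉ Z)
    (b : ULift.{u} (Fin (N + 1)) → ZMod 2) : ∃ b' : ULift.{u} (Fin (N + 1)) → ZMod 2,
      (∀ j, p j.down = x ∨ p j.down ∈ Z → b' j = b j) ∧
        ∀ j, HasParent N e j.down → b' j + parentSum N e (walkBits b') j.down = 0 := by
  classical
  let b' : ULift.{u} (Fin (N + 1)) → ZMod 2 := fun j =>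
    if p j.down ∈ Z then b j else walkBits b 0 + colliderSum p Z (walkBits b) j.down
  have hb' : ∀ i ≤ N, walkBits b' i =
      if p i ∈ Z then walkBits b i else walkBits b 0 + colliderSum p Z (walkBits b) i := by
    intro i hi
    simp only [walkBits, b', down_walkIndex hi]
  refine ⟨b', fun j hj => ?_, fun j hj => CharTwo.add_eq_zero.2 ?_⟩
  · rcases hj with hj | hj
    · obtain rfl := (hw.apply_eq_iff j).1 hj
      simp [b', down_walkIndex, hw.start, hx, colliderSum, walkBits]
    · exact if_pos hj
  · have := hw.eq_parentSum hx hN hb' (Nat.le_of_lt_succ j.down.2) hj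
    rwa [walkBits, walkIndex_down] at this

variable [DecidableEq V]

lemma dependsOn_colliderSum :
    DependsOn (fun b : ULift.{u} (Fin (N + 1)) → ZMod 2 => colliderSum p Z (walkBits b) N)
      {j | p j.down ∈ Z} := by
  intro b b' h
  refine Finset.sum_congr rfl fun i hi => ite_congr rfl (fun hZ => ?_) fun _ => rfl
  exact h (walkIndex N (i + 1)) (by simpa [down_walkIndex (Finset.mem_range.1 hi)] using hZ)

/-- The network of a back-door walk, with one bit for each position: a bit with parents on the walk
is their sum up to rare noise, the others are noise. -/
def network (hw : D.IsBackdoorWalk x Z N p e) (hx : x ∉ Z) (hN : p N ∉ Z) :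
    BackdoorNetwork D x (p N) Z (ULift.{u} (Fin (N + 1))) where
  node j := p j.down
  eqn j b := parentSum N e (walkBits b) j.down
  dependsOn_eqn := hw.dependsOn_parentSum
  inner := {j | HasParent N e j.down}
  src := walkIndex N 0
  dst := walkIndex N N
  parity b := colliderSum p Z (walkBits b) N
  node_eq_iff := hw.apply_eq_iff
  node_dst := congrArg p (down_walkIndex le_rfl)
  dependsOn_parity := dependsOn_colliderSum
  parity_zero := by simp [colliderSum, walkBits]
  eqn_zero j := by simp [parentSum, walkBits]
  eqn_single := hw.parentSum_single
  bit_dst b hb := hw.bit_eq_add_colliderSum hN fun j hj h => by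
    have := CharTwo.add_eq_zero.1 (hb (walkIndex N j) (by simpa [down_walkIndex hj] using h))
    rwa [down_walkIndex hj] at this
  exists_noiseless := hw.exists_noiseless hx hN

end IsBackdoorWalk

end Network

end DAG

/-! ### Adjustment sets and the back-door criterion -/

namespace DAG

variable {V : Type w} [Fintype V] [DecidableEq V] {D : DAG V} {x y : V}

lemma not_moralConn_of_isAdjustmentSet {a : V} {S C Z : Finset V}
    (h : IsAdjustmentSet.{u} D {x} {y} Z) (hS : S ⊆ D.ancestors (insert x (insert y Z)))
    (hZC : Z ⊆ C) (hx : x ∈ C) (ha : D.Adj a x) : ¬ D.MoralConn S C a y := by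
  intro hc
  obtain ⟨-, hxZ, hyZ⟩ := h.1
  have hstart : D.Reach x y Z False a false := .start ha
  obtain ⟨d, hd⟩ := hstart.trans_moralConn hS hZC hx hc
  obtain ⟨N, p, e, hw, rfl, -⟩ := hd.exists_isBackdoorWalk
  exact (hw.network (by simpa using hxZ) (by simpa using hyZ)).not_isAdjustmentSet h

lemma MoralConn.of_inter_subset {A C C' : Finset V} {u v : V}
    (h : D.MoralConn (D.ancestors A) C u v) (hC : C' ∩ D.ancestors A ⊆ C) :
    D.MoralConn (D.ancestors A) C' u v := by
  have hnotMem : ∀ {a c}, a ∉ C → c ∈ D.ancestors A → (a = c ∨ D.Adj a c) → a ∉ C' := by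
    rintro a c ha hc hac ha'
    refine ha (hC (Finset.mem_inter.2 ⟨ha', ?_⟩))
    rcases hac with rfl | hac
    exacts [hc, mem_ancestors_of_isAncestor (.single hac) hc]
  refine Relation.ReflTransGen.mono (fun a b hab => ?_) _ _ h
  obtain ⟨ha, hb, c, hc, hac, hbc⟩ := hab
  exact ⟨hnotMem ha hc hac, hnotMem hb hc hbc, c, hc, hac, hbc⟩

lemma satisfiesBackdoor_inter_ancestors {Z : Finset V} (h : IsAdjustmentSet.{u} D {x} {y} Z)
    (hxZ : ∀ z ∈ Z, ¬ D.IsAncestor x z) :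
    D.SatisfiesBackdoor {x} y (Z ∩ D.ancestors {x, y}) where
  notMem_left := Finset.disjoint_singleton_right.1 h.1.1
  notMem_right hy := Finset.disjoint_left.1 h.1.2.2 (Finset.mem_singleton_self y)
    (Finset.mem_inter.1 hy).1
  not_isAncestor x' hx' z hz := by
    rw [Finset.mem_singleton.1 hx']
    exact hxZ z (Finset.mem_inter.1 hz).1
  not_moralConn x' hx' a ha hc := by
    rw [Finset.mem_singleton.1 hx'] at ha
    have hS : D.ancestors ({x} ∪ {y} ∪ Z ∩ D.ancestors {x, y}) ⊆ D.ancestors {x, y} :=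
      ancestors_subset_ancestors (Finset.union_subset (fun v hv => mem_ancestors_of_mem hv)
        Finset.inter_subset_right)
    refine not_moralConn_of_isAdjustmentSet h (C := {x} ∪ Z) (hS.trans (ancestors_mono (by grind)))
      Finset.subset_union_right (by simp) ha (hc.of_inter_subset fun v hv => ?_)
    have := hS (Finset.mem_inter.1 hv).2
    grind

/-- A connection from `b` to `y` that is cut by `x` contains a moral edge from `m` to `x`, given by
a node `c` among `x` and its children. If `c` is a child, then `m` and `y` are connected through
`c`; otherwise a back-door connection from `x` to `y` would also connect `m` and `y`. -/
lemma isAncestor_and_satisfiesBackdoor_of_separates {b : V} {T : Finset V} (hyx : y ≠ x)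
    (hbT : b ∉ T) (hyT : y ∉ T) (hxb : ¬ D.IsAncestor x b) (hxT : ∀ t ∈ T, ¬ D.IsAncestor x t)
    (hconn : D.MoralConn (D.ancestors (insert b (insert y T))) T b y)
    (hsep : ¬ D.MoralConn (D.ancestors (insert b (insert y T))) ({x} ∪ T) b y) :
    D.IsAncestor x y ∧ D.SatisfiesBackdoor {x} y T := by
  set S := D.ancestors (insert b (insert y T))
  have hbx : b ≠ x := fun h => hxb (h ▸ .refl)
  obtain ⟨m, hbm, -, -, c, hcS, hmc, hxc⟩ :=
    hconn.exists_moralAdj_of_not_moralConn hsep (by simp [hbx, hbT])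
  have hm : m ∉ {x} ∪ T := hbm.notMem (by simp [hbT, hbx])
  have hxc' : D.IsAncestor x c := hxc.elim (fun h => h ▸ .refl) .single
  have hcy : D.IsAncestor c y := by
    obtain ⟨t, ht, hct⟩ := mem_ancestors.1 hcS
    rcases Finset.mem_insert.1 ht with rfl | ht
    · exact absurd (hxc'.trans hct) hxb
    rcases Finset.mem_insert.1 ht with rfl | ht
    · exact hct
    · exact absurd (hxc'.trans hct) (hxT t ht)
  refine ⟨hxc'.trans hcy, by simpa using hyx, hyT, by simpa using hxT, ?_⟩
  simp only [Finset.mem_singleton, forall_eq]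
  intro a hax hay
  have hyS : y ∈ S := mem_ancestors_of_mem (by simp)
  have hay' : D.MoralConn S ({x} ∪ T) a y :=
    hay.mono (ancestors_subset_ancestors (Finset.union_subset (Finset.union_subset
      (by simpa using mem_ancestors_of_isAncestor hxc' hcS) (by simpa using hyS))
      fun t ht => mem_ancestors_of_mem (by simp [ht])))
  suffices D.MoralConn S ({x} ∪ T) m y from hsep (hbm.trans this)
  rcases hxc with rfl | hxc
  · have haC : a ∉ {x} ∪ T := hay'.symm.notMem (by simp [hyT, hyx])
    have hmx : D.Adj m x := hmc.resolve_left fun h => hm (by simp [h])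
    exact .head ⟨hm, haC, x, hcS, .inr hmx, .inr hax⟩ hay'
  · have hC : ∀ t, D.IsAncestor c t → t ∉ {x} ∪ T := fun t hct ht => by
      rcases Finset.mem_union.1 ht with ht | ht
      · exact not_isAncestor_of_adj hxc (Finset.mem_singleton.1 ht ▸ hct)
      · exact hxT t ht (hxc'.trans hct)
    have hcy' : D.MoralConn S ({x} ∪ T) c y :=
      .of_isAncestor hcy (fun t ht => mem_ancestors_of_isAncestor ht hyS) fun t ht _ => hC t ht
    rcases hmc with rfl | hmc
    · exact hcy'
    · exact .head (.of_adj hmc hm (hC c .refl) hcS) hcy'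

end DAG

section MinimalAdjustmentSets

variable {V : Type w} [Fintype V] [DecidableEq V] {D : DAG V} {y : V}

lemma IsMinimalAdjustmentSet.subset_ancestors {x : V} {Z : Finset V}
    (h : IsMinimalAdjustmentSet.{u} D {x} {y} Z) (hxZ : ∀ z ∈ Z, ¬ D.IsAncestor x z) :
    Z ⊆ D.ancestors {x, y} := by
  by_contra hZ
  refine h.2 (Z ∩ D.ancestors {x, y}) ?_
    (DAG.satisfiesBackdoor_inter_ancestors h.1 hxZ).isAdjustmentSet
  exact Finset.inter_subset_left.ssubset_of_ne fun heq => hZ (Finset.inter_eq_left.1 heq)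

lemma IsAdjustmentSet.exists_isMinimalAdjustmentSet_subset {X Y Z : Finset V}
    (h : IsAdjustmentSet.{u} D X Y Z) : ∃ Z' ⊆ Z, IsMinimalAdjustmentSet.{u} D X Y Z' := by
  obtain ⟨Z', hZ', hmin⟩ :=
    exists_minimal_le_of_wellFoundedLT (fun Z' => IsAdjustmentSet.{u} D X Y Z') Z h
  exact ⟨Z', hZ', hmin.1, fun _ hlt => hmin.not_prop_of_lt hlt⟩

theorem DAG.satisfiesBackdoor_biUnion_sdiff {ι : Type*} [Fintype ι] {X : ι → V} {Z : ι → Finset V}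
    (hXy : ∀ i, D.IsAncestor (X i) y) (hZ : ∀ i, IsMinimalAdjustmentSet.{u} D {X i} {y} (Z i))
    (hXZ : ∀ i, ∀ z ∈ Z i, ¬ D.IsAncestor (X i) z)
    (hX : ∀ i j, ∀ z ∈ Z j, z ∉ Finset.univ.image X → ¬ D.IsAncestor (X i) z) :
    D.SatisfiesBackdoor (Finset.univ.image X) y
      (Finset.univ.biUnion Z \ Finset.univ.image X) where
  notMem_left hy := by
    obtain ⟨i, -, rfl⟩ := Finset.mem_image.1 hy
    simpa using (hZ i).1.1.1
  notMem_right hy := by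
    obtain ⟨i, -, hi⟩ := Finset.mem_biUnion.1 (Finset.mem_sdiff.1 hy).1
    exact Finset.disjoint_left.1 (hZ i).1.1.2.2 (Finset.mem_singleton_self y) hi
  not_isAncestor x hx z hz := by
    obtain ⟨i, -, rfl⟩ := Finset.mem_image.1 hx
    obtain ⟨hz, hzX⟩ := Finset.mem_sdiff.1 hz
    obtain ⟨j, -, hj⟩ := Finset.mem_biUnion.1 hz
    exact hX i j z hj hzX
  not_moralConn x hx a hax := by
    obtain ⟨i, -, rfl⟩ := Finset.mem_image.1 hx
    have hXi : ∀ j, X j ∈ D.ancestors {y} := fun j => DAG.mem_ancestors.2 ⟨y, by simp, hXy j⟩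
    have hZy : ∀ j, Z j ⊆ D.ancestors {y} := fun j =>
      ((hZ j).subset_ancestors (hXZ j)).trans (DAG.ancestors_subset_ancestors
        (Finset.insert_subset (hXi j) fun v hv => DAG.mem_ancestors_of_mem hv))
    have hS : D.ancestors (Finset.univ.image X ∪ {y} ∪
        (Finset.univ.biUnion Z \ Finset.univ.image X)) ⊆ D.ancestors {y} :=
      DAG.ancestors_subset_ancestors (Finset.union_subset (Finset.union_subset
        (by simpa [Finset.image_subset_iff] using hXi) fun v hv => DAG.mem_ancestors_of_mem hv)
        (Finset.sdiff_subset.trans (Finset.biUnion_subset.2 fun j _ => hZy j)))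
    refine DAG.not_moralConn_of_isAdjustmentSet (hZ i).1 (hS.trans (DAG.ancestors_mono (by simp)))
      ?_ (by simp) hax
    rw [Finset.union_sdiff_self_eq_union]
    exact (Finset.subset_biUnion_of_mem Z (Finset.mem_univ i)).trans Finset.subset_union_right

end MinimalAdjustmentSets

lemma CausalModel.isAncestor_and_satisfiesBackdoor {V : Type w} [Fintype V] [DecidableEq V]
    {Ω : V → Type u} [∀ v, MeasurableSpace (Ω v)] {μ : ∀ v, Measure (Ω v)}
    [∀ v, SigmaFinite (μ v)] (M : CausalModel Ω μ) {b x y : V} {T : Finset V} (hby : b ≠ y)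
    (hyx : y ≠ x) (hbT : b ∉ T) (hyT : y ∉ T) (hxb : ¬ M.graph.IsAncestor x b)
    (hxT : ∀ t ∈ T, ¬ M.graph.IsAncestor x t) (hdep : ¬ CondIndepDensity μ M.density {b} {y} T)
    (hindep : CondIndepDensity μ M.density {b} {y} (T ∪ {x})) :
    M.graph.IsAncestor x y ∧ M.graph.SatisfiesBackdoor {x} y T := by
  have hbx : b ≠ x := fun h => hxb (h ▸ .refl)
  refine DAG.isAncestor_and_satisfiesBackdoor_of_separates hyx hbT hyT hxb hxT ?_ ?_
  · by_contra hc
    exact hdep (M.compatible.condIndepDensity hyT hc)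
  · have hsep : M.graph.DSep {b} {y} (T ∪ {x}) := M.faithful {b} {y} (T ∪ {x})
      (by simpa using hby) (by simp [hbT, hbx]) (by simp [hyT, hyx]) hindep
    rw [Finset.union_comm {x} T]
    exact hsep.not_moralConn hby (DAG.ancestors_mono (by grind))

theorem theorem3 {V : Type w} [Fintype V] [DecidableEq V] {Ω : V → Type u}
    [∀ v, MeasurableSpace (Ω v)] (μ : ∀ v, Measure (Ω v)) [∀ v, SigmaFinite (μ v)]
    (M : CausalModel Ω μ)
    {k : ℕ} (hk : 1 ≤ k) (X : Fin k → V) (hX : Function.Injective X) (Y : V) (W : Finset V)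
    (hXY : Disjoint (Finset.univ.image X) {Y}) (hXW : Disjoint (Finset.univ.image X) W)
    (hYW : Disjoint {Y} W)
    (hord : M.graph.IsCausalOrdering [W, Finset.univ.image X, {Y}])
    (Wi : Fin k → V) (hWi : ∀ i, Wi i ∈ W) (T : Fin k → Finset V)
    (hT : ∀ i, T i ⊆ (W \ Finset.univ.image Wi) ∪
      M.graph.nonDescendantsIn (Finset.univ.image X) (X i))
    (hdep : ∀ i, ¬ CondIndepDensity μ M.density {Wi i} {Y} (T i))
    (hindep : ∀ i, CondIndepDensity μ M.density {Wi i} {Y} (T i ∪ {X i})) :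
    M.graph.HasCausalEffect (Finset.univ.image X) {Y} ∧
      (∀ i, ∃ Z ⊆ T i, IsMinimalAdjustmentSet.{u} M.graph {X i} {Y} Z) ∧
      ∀ Z : Fin k → Finset V,
        (∀ i, Z i ⊆ T i ∧ IsMinimalAdjustmentSet.{u} M.graph {X i} {Y} (Z i)) →
          IsAdjustmentSet.{u} M.graph (Finset.univ.image X) {Y}
            (Finset.univ.biUnion Z \ Finset.univ.image X) := by
  have hWX : ∀ b ∈ W, ∀ x ∈ Finset.univ.image X, ¬ M.graph.IsAncestor x b :=
    (List.pairwise_cons.1 hord).1 _ (by simp)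
  have hXmem : ∀ i, X i ∈ Finset.univ.image X := by simp
  have hXW' : ∀ b ∈ W, b ∉ Finset.univ.image X := fun b hb hbX => hWX b hb b hbX .refl
  have hYX : Y ∉ Finset.univ.image X := Finset.disjoint_singleton_right.1 hXY
  have hYW' : Y ∉ W := Finset.disjoint_singleton_left.1 hYW
  have hTmem : ∀ i, ∀ t ∈ T i, (t ∈ W ∧ t ∉ Finset.univ.image Wi) ∨
      (t ∈ Finset.univ.image X ∧ ¬ M.graph.IsAncestor (X i) t) := fun i t ht => by
    simpa only [DAG.nonDescendantsIn, Finset.mem_union, Finset.mem_sdiff, Finset.mem_filter]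
      using hT i ht
  have hXT : ∀ i, ∀ t ∈ T i, ¬ M.graph.IsAncestor (X i) t := fun i t ht =>
    (hTmem i t ht).elim (fun h => hWX t h.1 _ (hXmem i)) And.right
  have hback : ∀ i, M.graph.IsAncestor (X i) Y ∧ M.graph.SatisfiesBackdoor {X i} Y (T i) :=
    fun i => M.isAncestor_and_satisfiesBackdoor (by grind) (by grind) (by grind) (by grind)
      (hWX _ (hWi i) _ (hXmem i)) (hXT i) (hdep i) (hindep i)
  refine ⟨⟨X ⟨0, hk⟩, hXmem _, Y, Finset.mem_singleton_self Y, (hback _).1⟩,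
    fun i => (hback i).2.isAdjustmentSet.exists_isMinimalAdjustmentSet_subset, fun Z hZ => ?_⟩
  refine (DAG.satisfiesBackdoor_biUnion_sdiff (fun i => (hback i).1) (fun i => (hZ i).2)
    (fun i z hz => hXT i z ((hZ i).1 hz)) fun i j z hz hzX => ?_).isAdjustmentSet
  exact (hTmem j z ((hZ j).1 hz)).elim (fun h => hWX z h.1 _ (hXmem i)) fun h => absurd h.1 hzX
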